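/- Let $s>5/2$, let $S^1=\mathbb R/\mathbb Z$ be the circle of length one and $S^1_{4\pi}=\mathbb R/4\pi\mathbb Z$. Let $H^s_0(S^1;\mathbb R)$ be the space of real functions of Sobolev class $H^s$ on $S^1$ vanishing at $0$, let $\mathrm{Diff}^s_0(S^1)=\{\mathrm{id}+h : h\in H^s_0(S^1;\mathbb R),\ h_x>-1\}$, and let $K^s=\mathrm{Diff}_0^s(S^1)\times \big(H^{s-1}(S^1;S^1_{4\pi})/S^1_{4\pi}\big)$, where maps differing by a constant phase are identified. $K^s$ is a Banach manifold modeled on $H_0^s(S^1;\mathbb R)\times(H^{s-1}(S^1;\mathbb R)/\mathbb R)$, which is also its tangent space at every point $(\varphi,[\alpha])$; let $e=(\mathrm{id},[0])$. With $\pi(\rho)=\rho-\int_{S^1}\rho\,dx$, consider for $u=(u_1,[u_2])$, $v=(v_1,[v_2])\in T_eK^s$ $$\langle u,v\rangle=\tfrac14\int_{S^1}\big(u_{1x}v_{1x}+\pi(u_2)\pi(v_2)\big)dx,\qquad \|u\|^2=\langle u,u\rangle,$$ $$Ju=\Big(-\int_0^x\pi(u_2)\,dy,\,[u_{1x}]\Big),\qquad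 \omega(u,v)=\tfrac14\int_{S^1}(u_{2x}v_1-v_{2x}u_1)\,dx .$$ Let $\nabla$ be the connection $\nabla_XY=DY\cdot X-\Gamma(Y,X)$ on $K^s$, where $$\Gamma_e(u,v)=-\tfrac12\Big(A^{-1}\partial_x\big(u_{1x}v_{1x}+\pi(u_2)\pi(v_2)\big),\ \big[u_{1x}\pi(v_2)+v_{1x}\pi(u_2)\big]\Big),$$ $$(A^{-1}f)(x)=-\int_0^x\!\int_0^y f(z)\,dz\,dy+x\int_{S^1}\!\int_0^y f(z)\,dz\,dy \quad\text{if } \int_{S^1}f\,dx=0,$$ and $\Gamma_{(\varphi,[\alpha])}(u\circ\varphi,v\circ\varphi)=\Gamma_e(u,v)\circ\varphi$. Then the value at $e$ of $\nabla_X\nabla_YZ-\nabla_Y\nabla_XZ-\nabla_{[X,Y]}Z$, for smooth vector fields $X,Y,Z$ on $K^s$, depends only on the values of $X,Y,Z$ at $e$. Denote it by $R(X_e,Y_e)Z_e$; $R$ is the curvature tensor at $e$. For all $u,v\in T_eK^s$, $$\langle R(u,v)v,u\rangle=\|u\|^2\|v\|^2-\langle u,v\rangle^2+3\,\omega(u,v)^2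 .$$ Consequently, for linearly independent $u,v\in T_eK^s$ the sectional curvature $$\mathrm{sec}(u,v)=\frac{\langle R(u,v)v,u\rangle}{\|u\|^2\|v\|^2-\langle u,v\rangle^2}$$ satisfies $1\le \mathrm{sec}(u,v)\le 4$. If moreover $\langle u,v\rangle=0$, then $\mathrm{sec}(u,v)=4$ if and only if $Ju$ is a real multiple of $v$. Without the orthogonality assumption, $\mathrm{sec}(u,v)=4$ if and only if $Ju$ lies in the real span of $u$ and $v$. -/

import Mathlib

open Set Topology
open scoped Manifold ContDiff

noncomputable section

namespace HunterSaxton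

/-! ### Sobolev spaces on the circle of length one

For `s > 1/2` every Sobolev class has a unique continuous representative, so in this range `H^s` is
the space of continuous functions whose Fourier coefficients satisfy the weighted summability
condition. Only the exponents `s` and `s - 1` with `s > 5/2` are used below. -/

/-- The `n`-th Fourier coefficient of a real-valued function on the circle. -/
def coeff (f : C(UnitAddCircle, ℝ)) (n : ℤ) : ℂ :=
  fourierCoeff (T := (1 : ℝ)) (fun x => ((f x : ℝ) : ℂ)) n

theorem integrable_ofReal (f : C(UnitAddCircle, ℝ)) :
    MeasureTheory.Integrable (fun x => ((f x : ℝ) : ℂ)) (AddCircle.haarAddCircle (T := (1 : ℝ))) :=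
  (Complex.continuous_ofReal.comp f.continuous).integrable_of_hasCompactSupport
    (HasCompactSupport.of_compactSpace _)

theorem coeff_add (f g : C(UnitAddCircle, ℝ)) (n : ℤ) : coeff (f + g) n = coeff f n + coeff g n := by
  unfold coeff
  rw [← Pi.add_apply, ← fourierCoeff.add (integrable_ofReal f) (integrable_ofReal g)]
  congr 1
  ext x
  simp

theorem coeff_smul (c : ℝ) (f : C(UnitAddCircle, ℝ)) (n : ℤ) :
    coeff (c • f) n = (c : ℂ) * coeff f n := by
  unfold coeff
  rw [← fourierCoeff.const_mul]
  simp

theorem coeff_one (n : ℤ) : coeff 1 n = if n = 0 then 1 else 0 := by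
  unfold coeff
  have h : (fun x : UnitAddCircle => (((1 : C(UnitAddCircle, ℝ)) x : ℝ) : ℂ)) = fourier (T := 1) 0 := by
    ext x; simp
  rw [h, fourierCoeff_fourier]
  by_cases hn : n = 0
  · subst hn; simp
  · simp [hn]

/-- The function regarded as complex-valued. -/
def toComplex (f : C(UnitAddCircle, ℝ)) : C(UnitAddCircle, ℂ) :=
  ⟨fun x => ((f x : ℝ) : ℂ), Complex.continuous_ofReal.comp f.continuous⟩

theorem eq_zero_of_coeff_eq_zero {f : C(UnitAddCircle, ℝ)} (h : ∀ n, coeff f n = 0) : f = 0 := by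
  have hz : fourierCoeff (T := (1 : ℝ)) (toComplex f) = 0 := funext h
  ext x
  have hsum := has_pointwise_sum_fourier_series_of_summable (f := toComplex f)
    (by rw [hz]; exact summable_zero) x
  rw [hz] at hsum
  simp only [Pi.zero_apply, zero_smul] at hsum
  have h2 : ((f x : ℝ) : ℂ) = 0 := hsum.unique hasSum_zero
  exact_mod_cast h2

/-- The Fourier weights `(1 + n²)^{s/2}` of the Sobolev norm. -/
def weight (s : ℝ) (n : ℤ) : ℝ := (1 + (n : ℝ) ^ 2) ^ (s / 2)

theorem weight_pos (s : ℝ) (n : ℤ) : 0 < weight s n := by unfold weight; positivity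

/-- The Sobolev condition `(1 + n²)^{s/2} f̂(n) ∈ ℓ²`, as a real linear subspace. -/
def sobolevSubmodule (s : ℝ) : Submodule ℝ C(UnitAddCircle, ℝ) where
  carrier := {f | Memℓp (fun n : ℤ => (weight s n : ℂ) * coeff f n) 2}
  add_mem' := by
    intro f g hf hg
    have h := Memℓp.add hf hg
    have he : (fun n : ℤ => (weight s n : ℂ) * coeff (f + g) n)
        = (fun n : ℤ => (weight s n : ℂ) * coeff f n) + fun n : ℤ => (weight s n : ℂ) * coeff g n := by
      ext n
      simp [coeff_add, mul_add]
    show Memℓp (fun n : ℤ => (weight s n : ℂ) * coeff (f + g) n) 2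
    rw [he]
    exact h
  zero_mem' := by
    have h : ∀ n, coeff 0 n = 0 := fun n => by
      simpa using coeff_smul 0 (0 : C(UnitAddCircle, ℝ)) n
    show Memℓp (fun n : ℤ => (weight s n : ℂ) * coeff 0 n) 2
    simp only [h, mul_zero]
    exact zero_memℓp
  smul_mem' := by
    intro c f hf
    have h := Memℓp.const_smul hf c
    have he : (fun n : ℤ => (weight s n : ℂ) * coeff (c • f) n)
        = c • fun n : ℤ => (weight s n : ℂ) * coeff f n := by
      ext n
      simp [coeff_smul]
      ring
    show Memℓp (fun n : ℤ => (weight s n : ℂ) * coeff (c • f) n) 2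
    rw [he]
    exact h

/-- The Sobolev space `H^s(S¹; ℝ)`. -/
def Sob (s : ℝ) : Type := sobolevSubmodule s

instance (s : ℝ) : AddCommGroup (Sob s) := inferInstanceAs (AddCommGroup (sobolevSubmodule s))
instance (s : ℝ) : Module ℝ (Sob s) := inferInstanceAs (Module ℝ (sobolevSubmodule s))

/-- The underlying continuous function on the circle. -/
def Sob.toCont {s : ℝ} : Sob s →ₗ[ℝ] C(UnitAddCircle, ℝ) := (sobolevSubmodule s).subtype

/-- An element of `H^s(S¹; ℝ)` as a `1`-periodic function on `ℝ`. -/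
def Sob.fn {s : ℝ} (f : Sob s) : ℝ → ℝ := fun x => f.toCont (x : UnitAddCircle)

/-- The weighted sequence of Fourier coefficients. -/
def Sob.toL2 (s : ℝ) : Sob s →ₗ[ℝ] lp (fun _ : ℤ => ℂ) 2 where
  toFun f := ⟨fun n => (weight s n : ℂ) * coeff f.toCont n, f.2⟩
  map_add' f g := by
    ext n
    simp only [map_add, coeff_add, mul_add]
    rfl
  map_smul' c f := by
    ext n
    simp [coeff_smul]
    ring

theorem Sob.toL2_injective (s : ℝ) : Function.Injective (Sob.toL2 s) := by
  rw [injective_iff_map_eq_zero]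
  intro f h
  apply Subtype.ext
  apply eq_zero_of_coeff_eq_zero
  intro n
  have h1 := congrArg (fun k : lp (fun _ : ℤ => ℂ) 2 => k n) h
  have h2 : (weight s n : ℂ) * coeff f.toCont n = 0 := h1
  have h3 : (weight s n : ℂ) ≠ 0 := by exact_mod_cast (weight_pos s n).ne'
  exact (mul_eq_zero.1 h2).resolve_left h3

/-- The Sobolev norm `‖f‖² = ∑ (1 + n²)^s |f̂(n)|²`. -/
instance (s : ℝ) : NormedAddCommGroup (Sob s) :=
  NormedAddCommGroup.induced (Sob s) (lp (fun _ : ℤ => ℂ) 2) (Sob.toL2 s) (Sob.toL2_injective s)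

instance (s : ℝ) : NormedSpace ℝ (Sob s) :=
  NormedSpace.induced ℝ (Sob s) (lp (fun _ : ℤ => ℂ) 2) (Sob.toL2 s)

theorem one_mem_sobolev (s : ℝ) : (1 : C(UnitAddCircle, ℝ)) ∈ sobolevSubmodule s := by
  show Memℓp (fun n : ℤ => (weight s n : ℂ) * coeff 1 n) 2
  refine memℓp_gen ?_
  refine summable_of_ne_finset_zero (s := {0}) ?_
  intro n hn
  have : n ≠ 0 := by simpa using hn
  simp [coeff_one, this]

/-- The constant function `1`. -/
def Sob.one (s : ℝ) : Sob s := ⟨1, one_mem_sobolev s⟩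

/-- The constant functions. -/
def Sob.consts (s : ℝ) : Submodule ℝ (Sob s) := Submodule.span ℝ {Sob.one s}

instance (s : ℝ) : IsClosed (Sob.consts s : Set (Sob s)) := by
  have : FiniteDimensional ℝ (Sob.consts s) := by unfold Sob.consts; infer_instance
  exact Submodule.closed_of_finiteDimensional _

/-- The subspace `H₀^s(S¹; ℝ)` of functions vanishing at `0`. -/
def Sob₀ (s : ℝ) : Submodule ℝ (Sob s) where
  carrier := {f | f.fn 0 = 0}
  add_mem' := by
    intro f g hf hg
    have hf' : f.fn 0 = 0 := hf
    have hg' : g.fn 0 = 0 := hg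
    show (f + g).fn 0 = 0
    simp only [Sob.fn, map_add, ContinuousMap.add_apply] at *
    rw [hf', hg', add_zero]
  zero_mem' := by simp [Sob.fn]
  smul_mem' := by
    intro c f hf
    have hf' : f.fn 0 = 0 := hf
    show (c • f).fn 0 = 0
    simp only [Sob.fn, map_smul, ContinuousMap.smul_apply] at *
    rw [hf', smul_zero]

open Classical in
/-- The element of `H^s` with the given underlying periodic function
(and `0` if the function is not of class `H^s`). -/
def Sob.ofFun (s : ℝ) (f : ℝ → ℝ) : Sob s :=
  if h : ∃ g : Sob s, g.fn = f then h.choose else 0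

open Classical in
/-- The element of `H₀^s` with the given underlying periodic function
(and `0` if the function is not of class `H₀^s`). -/
def Sob₀.ofFun (s : ℝ) (f : ℝ → ℝ) : Sob₀ s :=
  if h : ∃ g : Sob₀ s, (g : Sob s).fn = f then h.choose else 0

/-- The quotient `H^s(S¹; ℝ) / ℝ` by the constant functions, with the quotient norm. -/
abbrev SobModConst (s : ℝ) : Type := Sob s ⧸ Sob.consts s

/-- A function representing a class in `H^s(S¹; ℝ) / ℝ`. -/
def SobModConst.rep {s : ℝ} (ρ : SobModConst s) : ℝ → ℝ :=
  (Function.surjInv (Submodule.mkQ_surjective (Sob.consts s)) ρ).fn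

/-- The model space `H₀^s(S¹; ℝ) × (H^{s-1}(S¹; ℝ) / ℝ)`. -/
abbrev Model (s : ℝ) : Type := Sob₀ s × SobModConst (s - 1)

/-! ### Differentiability of Sobolev functions -/

theorem Sob.norm_eq {s : ℝ} (f : Sob s) : ‖f‖ = ‖Sob.toL2 s f‖ := rfl

theorem summable_weight {s : ℝ} (hs : 3 / 2 < s) :
    Summable fun n : ℤ => ((1 + |(n : ℝ)|) / weight s n) ^ (2 : ℝ) := by
  have h1 : Summable fun n : ℤ => 2 * |(n : ℝ)| ^ (-(2 * (s - 1))) :=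
    (Real.summable_abs_int_rpow (b := 2 * (s - 1)) (by linarith)).mul_left 2
  refine Summable.of_norm_bounded_eventually h1 ?_
  have hfin : ({0} : Set ℤ).Finite := finite_singleton 0
  filter_upwards [hfin.compl_mem_cofinite] with n hn
  have hn0 : n ≠ 0 := by simpa using hn
  have hx : 0 < |(n : ℝ)| := by simpa using hn0
  have hq : 0 < 1 + (n : ℝ) ^ 2 := by positivity
  rw [Real.norm_of_nonneg (Real.rpow_nonneg (div_nonneg (add_nonneg zero_le_one (abs_nonneg _)) (weight_pos s n).le) _), Real.rpow_two, div_pow]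
  have hw : weight s n ^ 2 = (1 + (n : ℝ) ^ 2) ^ s := by
    unfold weight
    rw [← Real.rpow_natCast, ← Real.rpow_mul hq.le]
    norm_num
  have h2 : (1 + |(n : ℝ)|) ^ 2 ≤ 2 * (1 + (n : ℝ) ^ 2) := by
    have := sq_abs (n : ℝ)
    nlinarith [sq_nonneg (1 - |(n : ℝ)|)]
  have h3 : (1 + (n : ℝ) ^ 2) ^ s = (1 + (n : ℝ) ^ 2) * (1 + (n : ℝ) ^ 2) ^ (s - 1) := by
    rw [← Real.rpow_one_add' hq.le (by linarith)]
    ring_nf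
  have h4 : (|(n : ℝ)| ^ (2 * (s - 1))) ≤ (1 + (n : ℝ) ^ 2) ^ (s - 1) := by
    rw [Real.rpow_mul hx.le, Real.rpow_two, sq_abs]
    exact Real.rpow_le_rpow (by positivity) (by linarith) (by linarith)
  rw [hw, h3, Real.rpow_neg hx.le, div_le_iff₀ (by positivity)]
  have hpos : 0 < |(n : ℝ)| ^ (2 * (s - 1)) := by positivity
  calc (1 + |(n : ℝ)|) ^ 2 ≤ 2 * (1 + (n : ℝ) ^ 2) := h2
    _ = 2 * (|(n : ℝ)| ^ (2 * (s - 1)))⁻¹ * ((1 + (n : ℝ) ^ 2) * |(n : ℝ)| ^ (2 * (s - 1))) := by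
      field_simp
    _ ≤ _ := by gcongr

/-- `∑ (1 + |n|) |f̂(n)|` is controlled by the Sobolev norm. -/
theorem Sob.exists_bound {s : ℝ} (hs : 3 / 2 < s) : ∃ C : ℝ, 0 ≤ C ∧ ∀ f : Sob s,
    Summable (fun n : ℤ => (1 + |(n : ℝ)|) * ‖coeff f.toCont n‖) ∧
      ∑' n : ℤ, (1 + |(n : ℝ)|) * ‖coeff f.toCont n‖ ≤ C * ‖f‖ := by
  refine ⟨(∑' n : ℤ, ((1 + |(n : ℝ)|) / weight s n) ^ (2 : ℝ)) ^ (1 / (2 : ℝ)),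
    Real.rpow_nonneg (tsum_nonneg fun n => Real.rpow_nonneg
      (div_nonneg (add_nonneg zero_le_one (abs_nonneg _)) (weight_pos s n).le) _) _, fun f => ?_⟩
  have hmem : Memℓp (fun n : ℤ => (weight s n : ℂ) * coeff f.toCont n) 2 := f.2
  have hsum : Summable fun n : ℤ => ‖(weight s n : ℂ) * coeff f.toCont n‖ ^ (2 : ℝ) := by
    simpa using hmem.summable (by norm_num)
  have hH := Real.summable_and_inner_le_Lp_mul_Lq_tsum_of_nonneg (p := 2) (q := 2)
    (by rw [Real.holderConjugate_iff]; norm_num)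
    (fun n : ℤ => div_nonneg (a := 1 + |(n : ℝ)|) (add_nonneg zero_le_one (abs_nonneg _)) (weight_pos s n).le)
    (fun n : ℤ => norm_nonneg ((weight s n : ℂ) * coeff f.toCont n))
    (summable_weight hs) hsum
  have he : (fun n : ℤ => (1 + |(n : ℝ)|) / weight s n * ‖(weight s n : ℂ) * coeff f.toCont n‖)
      = fun n : ℤ => (1 + |(n : ℝ)|) * ‖coeff f.toCont n‖ := by
    ext n
    have := weight_pos s n
    rw [norm_mul, Complex.norm_real, Real.norm_of_nonneg this.le]
    field_simp
  have hn : ‖f‖ = (∑' n : ℤ, ‖(weight s n : ℂ) * coeff f.toCont n‖ ^ (2 : ℝ)) ^ (1 / (2 : ℝ)) := by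
    rw [Sob.norm_eq, lp.norm_eq_tsum_rpow (by norm_num)]
    simp [Sob.toL2]
  rw [he, ← hn] at hH
  exact hH

theorem Sob.exists_deriv {s : ℝ} (hs : 3 / 2 < s) (f : Sob s) : ∃ d : ℝ → ℝ, Continuous d ∧
    (∀ x, HasDerivAt f.fn (d x) x) ∧
    ∀ x, |d x| ≤ 2 * Real.pi * ∑' n : ℤ, (1 + |(n : ℝ)|) * ‖coeff f.toCont n‖ := by
  obtain ⟨C, -, hC⟩ := Sob.exists_bound hs
  have hsum := (hC f).1
  have hle : ∀ n : ℤ, ‖coeff f.toCont n‖ ≤ (1 + |(n : ℝ)|) * ‖coeff f.toCont n‖ := fun n => by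
    nlinarith [norm_nonneg (coeff f.toCont n), abs_nonneg (n : ℝ)]
  have hs0 : Summable fun n : ℤ => coeff f.toCont n := Summable.of_norm_bounded hsum hle
  let g : ℤ → ℝ → ℂ := fun n x => coeff f.toCont n * fourier n (x : UnitAddCircle)
  let g' : ℤ → ℝ → ℂ := fun n x =>
    coeff f.toCont n * (2 * Real.pi * Complex.I * n / (1 : ℝ) * fourier n (x : UnitAddCircle))
  have hg : ∀ n x, HasDerivAt (g n) (g' n x) x := fun n x =>
    (hasDerivAt_fourier 1 n x).const_mul _
  have hu : Summable fun n : ℤ => 2 * Real.pi * ((1 + |(n : ℝ)|) * ‖coeff f.toCont n‖) :=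
    hsum.mul_left _
  have hg' : ∀ n x, ‖g' n x‖ ≤ 2 * Real.pi * ((1 + |(n : ℝ)|) * ‖coeff f.toCont n‖) := by
    intro n x
    have h1 : ‖fourier n (x : UnitAddCircle)‖ = 1 := Circle.norm_coe _
    have h2 : ‖g' n x‖ = 2 * Real.pi * (|(n : ℝ)| * ‖coeff f.toCont n‖) := by
      simp only [g', norm_mul, norm_div, h1, Complex.norm_I, Complex.norm_real, Complex.norm_intCast]
      simp [abs_of_pos Real.pi_pos]
      ring
    rw [h2]
    gcongr
    linarith
  have hfs : ∀ x : ℝ, HasSum (fun n => g n x) ((f.fn x : ℝ) : ℂ) := fun x =>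
    has_pointwise_sum_fourier_series_of_summable (f := toComplex f.toCont) hs0 (x : UnitAddCircle)
  have hd : ∀ x, HasDerivAt (fun x : ℝ => ((f.fn x : ℝ) : ℂ)) (∑' n, g' n x) x := by
    intro x
    have h := hasDerivAt_tsum hu hg hg' (y₀ := 0) (hfs 0).summable x
    have he : (fun z => ∑' n, g n z) = fun x : ℝ => ((f.fn x : ℝ) : ℂ) :=
      funext fun z => (hfs z).tsum_eq
    rwa [he] at h
  have hcont : Continuous fun x => ∑' n, g' n x := by
    refine continuous_tsum (fun n => ?_) hu hg'
    have : Continuous fun x : ℝ => fourier n (x : UnitAddCircle) :=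
      (fourier n).continuous.comp (AddCircle.continuous_mk' 1)
    exact continuous_const.mul (continuous_const.mul this)
  refine ⟨fun x => (∑' n, g' n x).re, Complex.continuous_re.comp hcont, fun x => ?_, fun x => ?_⟩
  · have h := Complex.reCLM.hasFDerivAt.comp_hasDerivAt x (hd x)
    exact h
  · refine (Complex.abs_re_le_norm _).trans ?_
    rw [← tsum_mul_left]
    exact tsum_of_norm_bounded hu.hasSum fun n => hg' n x

theorem Sob.hasDerivAt {s : ℝ} (hs : 3 / 2 < s) (f : Sob s) (x : ℝ) :
    HasDerivAt f.fn (deriv f.fn x) x := by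
  obtain ⟨d, -, h, -⟩ := Sob.exists_deriv hs f
  exact (h x).differentiableAt.hasDerivAt

theorem Sob.continuous_deriv {s : ℝ} (hs : 3 / 2 < s) (f : Sob s) : Continuous (deriv f.fn) := by
  obtain ⟨d, hc, h, -⟩ := Sob.exists_deriv hs f
  rwa [show deriv f.fn = d from funext fun x => (h x).deriv]

theorem Sob.exists_deriv_bound {s : ℝ} (hs : 3 / 2 < s) :
    ∃ C : ℝ, 0 ≤ C ∧ ∀ (f : Sob s) (x : ℝ), |deriv f.fn x| ≤ C * ‖f‖ := by
  obtain ⟨C, hC0, hC⟩ := Sob.exists_bound hs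
  refine ⟨2 * Real.pi * C, by positivity, fun f x => ?_⟩
  obtain ⟨d, -, h, hb⟩ := Sob.exists_deriv hs f
  rw [(h x).deriv, mul_assoc]
  exact (hb x).trans (mul_le_mul_of_nonneg_left (hC f).2 (by positivity))

theorem Sob.fn_add_one {s : ℝ} (f : Sob s) (x : ℝ) : f.fn (x + 1) = f.fn x := by
  unfold Sob.fn
  rw [AddCircle.coe_add_period]

/-- The set of `h` for which `id + h` is an orientation-preserving diffeomorphism. -/
def diffSet (s : ℝ) : Set (Sob₀ s) := {h | ∀ x : ℝ, -1 < deriv (h : Sob s).fn x}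

theorem isOpen_diffSet {s : ℝ} (hs : 3 / 2 < s) : IsOpen (diffSet s) := by
  obtain ⟨C, hC0, hC⟩ := Sob.exists_deriv_bound hs
  rw [Metric.isOpen_iff]
  intro h hh
  have hper : ∀ x, deriv (h : Sob s).fn (x + 1) = deriv (h : Sob s).fn x := fun x => by
    rw [← deriv_comp_add_const]
    congr 1
    exact funext fun y => Sob.fn_add_one _ y
  obtain ⟨x₀, -, hmin⟩ := isCompact_Icc.exists_isMinOn (nonempty_Icc.2 (zero_le_one (α := ℝ)))
    (Sob.continuous_deriv hs (h : Sob s)).continuousOn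
  have hall : ∀ x, deriv (h : Sob s).fn x₀ ≤ deriv (h : Sob s).fn x := fun x => by
    have hp : Function.Periodic (deriv (h : Sob s).fn) 1 := hper
    obtain ⟨y, hy, hxy⟩ := hp.exists_mem_Ico₀ one_pos x
    rw [hxy]
    exact hmin ⟨hy.1, hy.2.le⟩
  have h0 := hh x₀
  refine ⟨(deriv (h : Sob s).fn x₀ + 1) / (C + 1), div_pos (by linarith) (by linarith), ?_⟩
  intro k hk x
  have hk' : ‖(k : Sob s) - (h : Sob s)‖ < (deriv (h : Sob s).fn x₀ + 1) / (C + 1) := by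
    rw [Metric.mem_ball, dist_eq_norm] at hk
    exact hk
  rw [lt_div_iff₀ (by linarith)] at hk'
  have hsub : deriv ((k : Sob s) - (h : Sob s)).fn x
      = deriv (k : Sob s).fn x - deriv (h : Sob s).fn x := by
    have hfun : ((k : Sob s) - (h : Sob s)).fn = (k : Sob s).fn - (h : Sob s).fn := by
      ext y
      simp [Sob.fn]
    rw [hfun]
    exact ((Sob.hasDerivAt hs _ x).sub (Sob.hasDerivAt hs _ x)).deriv
  have hb := hC ((k : Sob s) - (h : Sob s)) x
  rw [hsub] at hb
  have h1 := (abs_le.1 hb).1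
  have h2 := hall x
  have h3 := norm_nonneg ((k : Sob s) - (h : Sob s))
  nlinarith

/-! ### The manifold `K^s` -/

/-- `Diff₀^s(S¹) = {id + h | h ∈ H^s(S¹; ℝ), h_x > -1, h(0) = 0}`. -/
structure Diff₀ (s : ℝ) : Type where
  disp : Sob₀ s
  mem : disp ∈ diffSet s

/-- The lift `φ = id + h : ℝ → ℝ` of a circle diffeomorphism. -/
def Diff₀.lift {s : ℝ} (φ : Diff₀ s) : ℝ → ℝ := fun x => x + (φ.disp : Sob s).fn x

/-- The identity diffeomorphism. -/
def Diff₀.id (s : ℝ) : Diff₀ s := ⟨0, by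
  intro x
  have h : ((0 : Sob₀ s) : Sob s).fn = fun _ => 0 := by ext x; simp [Sob.fn]
  rw [h, deriv_const]
  norm_num⟩

/-- `H^s(S¹; S¹_{4π})`: the maps `S¹ → S¹_{4π} = ℝ/4πℤ` of Sobolev class `H^s`, i.e. those with a
lift `x ↦ 4πnx + a(x)` to `ℝ`, where `n ∈ ℤ` is the winding number and `a ∈ H^s(S¹; ℝ)`. -/
def circleMaps (s : ℝ) : AddSubgroup C(UnitAddCircle, AddCircle (4 * Real.pi)) where
  carrier := {α | ∃ (n : ℤ) (a : Sob s), ∀ x : ℝ,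
    α (x : UnitAddCircle) = ((4 * Real.pi * n * x + a.fn x : ℝ) : AddCircle (4 * Real.pi))}
  add_mem' := by
    rintro α β ⟨n, a, ha⟩ ⟨m, b, hb⟩
    refine ⟨n + m, a + b, fun x => ?_⟩
    rw [ContinuousMap.add_apply, ha, hb, ← AddCircle.coe_add]
    congr 1
    simp [Sob.fn]
    ring
  zero_mem' := ⟨0, 0, fun x => by simp [Sob.fn]⟩
  neg_mem' := by
    rintro α ⟨n, a, ha⟩
    refine ⟨-n, -a, fun x => ?_⟩
    rw [ContinuousMap.neg_apply, ha, ← AddCircle.coe_neg]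
    congr 1
    simp [Sob.fn]
    ring

/-- The constant maps `S¹ → S¹_{4π}`. -/
def constPhases (s : ℝ) : AddSubgroup (circleMaps s) where
  carrier := {α | ∃ c : AddCircle (4 * Real.pi), ∀ x, α.1 x = c}
  add_mem' := by
    rintro α β ⟨c, hc⟩ ⟨d, hd⟩
    exact ⟨c + d, fun x => by simp [hc, hd]⟩
  zero_mem' := ⟨0, fun x => by simp⟩
  neg_mem' := by
    rintro α ⟨c, hc⟩
    exact ⟨-c, fun x => by simp [hc]⟩

/-- `H^s(S¹; S¹_{4π}) / S¹_{4π}`: maps up to a constant phase. -/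
abbrev Phase (s : ℝ) : Type := circleMaps s ⧸ constPhases s

/-- The map `x ↦ 4πnx + a(x)` from `S¹` to `S¹_{4π}`, as a continuous map. -/
def circleMapAux {s : ℝ} (n : ℤ) (a : Sob s) : C(UnitAddCircle, AddCircle (4 * Real.pi)) :=
  ⟨fun x => n • (AddCircle.homeomorphAddCircle (1 : ℝ) (4 * Real.pi) one_ne_zero (by positivity) x) +
      ((a.toCont x : ℝ) : AddCircle (4 * Real.pi)),
    ((Homeomorph.continuous _).zsmul n).add
      ((AddCircle.continuous_mk' _).comp a.toCont.continuous)⟩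

theorem circleMapAux_apply {s : ℝ} (n : ℤ) (a : Sob s) (x : ℝ) :
    circleMapAux n a (x : UnitAddCircle) =
      ((4 * Real.pi * n * x + a.fn x : ℝ) : AddCircle (4 * Real.pi)) := by
  show n • (AddCircle.homeomorphAddCircle (1 : ℝ) (4 * Real.pi) _ _ (x : UnitAddCircle)) +
      ((a.toCont (x : UnitAddCircle) : ℝ) : AddCircle (4 * Real.pi)) = _
  rw [AddCircle.homeomorphAddCircle_apply_mk, ← AddCircle.coe_zsmul, ← AddCircle.coe_add]
  congr 1
  simp [Sob.fn]
  ring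

/-- The map `x ↦ 4πnx + a(x)` from `S¹` to `S¹_{4π}`. -/
def circleMap {s : ℝ} (n : ℤ) (a : Sob s) : circleMaps s :=
  ⟨circleMapAux n a, n, a, circleMapAux_apply n a⟩

theorem circleMap_apply {s : ℝ} (n : ℤ) (a : Sob s) (x : ℝ) :
    (circleMap n a).1 (x : UnitAddCircle) =
      ((4 * Real.pi * n * x + a.fn x : ℝ) : AddCircle (4 * Real.pi)) :=
  circleMapAux_apply n a x

theorem mem_consts_iff {s : ℝ} (a : Sob s) : a ∈ Sob.consts s ↔ ∃ c : ℝ, ∀ x, a.fn x = c := by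
  unfold Sob.consts
  rw [Submodule.mem_span_singleton]
  constructor
  · rintro ⟨c, rfl⟩
    refine ⟨c, fun x => ?_⟩
    have h1 : (Sob.one s).toCont = 1 := rfl
    simp [Sob.fn, h1]
  · rintro ⟨c, hc⟩
    refine ⟨c, ?_⟩
    apply Subtype.ext
    show (c • Sob.one s).toCont = a.toCont
    ext x
    induction x using QuotientAddGroup.induction_on with
    | H x =>
      have h1 : (Sob.one s).toCont = 1 := rfl
      have h2 : a.toCont (x : UnitAddCircle) = c := hc x
      rw [map_smul, h1]
      simpa using h2.symm

theorem circleMap_rel_iff {s : ℝ} (n m : ℤ) (a b : Sob s) :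
    -circleMap n a + circleMap m b ∈ constPhases s ↔ n = m ∧ a - b ∈ Sob.consts s := by
  have happ : ∀ x : ℝ, (-circleMap n a + circleMap m b).1 (x : UnitAddCircle) =
      ((4 * Real.pi * (m - n) * x + (b.fn x - a.fn x) : ℝ) : AddCircle (4 * Real.pi)) := by
    intro x
    show -(circleMap n a).1 (x : UnitAddCircle) + (circleMap m b).1 (x : UnitAddCircle) = _
    rw [circleMap_apply, circleMap_apply, ← AddCircle.coe_neg, ← AddCircle.coe_add]
    congr 1
    ring
  rw [mem_consts_iff]
  constructor
  · rintro ⟨c, hc⟩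
    have hx : ∀ x : ℝ, ∃ k : ℤ, 4 * Real.pi * (m - n) * x + (b.fn x - a.fn x)
        - (b.fn 0 - a.fn 0) = k * (4 * Real.pi) := by
      intro x
      have h1 := (happ x).symm.trans (hc x)
      have h2 := (happ 0).symm.trans (hc 0)
      have h3 := h1.trans h2.symm
      rw [← sub_eq_zero, ← AddCircle.coe_sub, AddCircle.coe_eq_zero_iff] at h3
      obtain ⟨k, hk⟩ := h3
      refine ⟨k, ?_⟩
      rw [zsmul_eq_mul] at hk
      rw [hk]
      ring
    choose k hk using hx
    have hcf : ∀ f : Sob s, Continuous f.fn := fun f =>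
      f.toCont.continuous.comp (AddCircle.continuous_mk' 1)
    have hkc : Continuous k := by
      rw [Int.isClosedEmbedding_coe_real.isInducing.continuous_iff]
      have he : (fun z : ℤ => (z : ℝ)) ∘ k = fun x => (4 * Real.pi * (m - n) * x
          + (b.fn x - a.fn x) - (b.fn 0 - a.fn 0)) / (4 * Real.pi) := by
        ext x
        rw [hk x, mul_div_assoc, div_self (by positivity), mul_one]
        rfl
      rw [he]
      have := hcf a
      have := hcf b
      fun_prop
    have hk0 : k 0 = 0 := by
      have h := hk 0
      have h' : (k 0 : ℝ) * (4 * Real.pi) = 0 := by rw [← h]; ring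
      have h'' := (mul_eq_zero.1 h').resolve_right (by positivity)
      exact_mod_cast h''
    have hz : ∀ x, 4 * Real.pi * (m - n) * x + (b.fn x - a.fn x) - (b.fn 0 - a.fn 0) = 0 := by
      intro x
      rw [hk x, PreconnectedSpace.constant inferInstance hkc (x := x) (y := 0), hk0]
      simp
    have h1 := hz 1
    have hb1 : b.fn 1 = b.fn 0 := by simpa using b.fn_add_one 0
    have ha1 : a.fn 1 = a.fn 0 := by simpa using a.fn_add_one 0
    rw [hb1, ha1] at h1
    have h2 : 4 * Real.pi * ((m : ℝ) - n) = 0 := by linarith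
    have h3 : (m : ℝ) - n = 0 := (mul_eq_zero.1 h2).resolve_left (by positivity)
    have hmn : (n : ℝ) = m := by linarith
    refine ⟨by exact_mod_cast hmn, a.fn 0 - b.fn 0, fun x => ?_⟩
    have h4 := hz x
    rw [h3] at h4
    have h5 : (a - b).fn x = a.fn x - b.fn x := by simp [Sob.fn]
    rw [h5]
    linarith
  · rintro ⟨rfl, c, hc⟩
    refine ⟨((-c : ℝ) : AddCircle (4 * Real.pi)), fun x => ?_⟩
    induction x using QuotientAddGroup.induction_on with
    | H x =>
      refine (happ x).trans ?_
      congr 1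
      have h5 : (a - b).fn x = a.fn x - b.fn x := by simp [Sob.fn]
      have h6 := hc x
      rw [h5] at h6
      rw [← h6]
      ring

/-- The class of `x ↦ 4πnx + a(x)` modulo constant phases, in terms of the class of `a`. -/
def Phase.mk {s : ℝ} (n : ℤ) (ρ : SobModConst s) : Phase s :=
  Quotient.liftOn ρ (fun a => (QuotientAddGroup.mk (circleMap n a) : circleMaps s ⧸ constPhases s))
    (fun a b hab => QuotientAddGroup.eq.2
      ((circleMap_rel_iff n n a b).2 ⟨rfl, (Submodule.quotientRel_def _).1 hab⟩))

theorem Phase.mk_bijective (s : ℝ) :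
    Function.Bijective (fun q : ℤ × SobModConst s => Phase.mk q.1 q.2) := by
  constructor
  · rintro ⟨n, ρ⟩ ⟨m, σ⟩ h
    obtain ⟨a, rfl⟩ := Submodule.mkQ_surjective _ ρ
    obtain ⟨b, rfl⟩ := Submodule.mkQ_surjective _ σ
    have h' : (QuotientAddGroup.mk (circleMap n a) : circleMaps s ⧸ constPhases s)
        = QuotientAddGroup.mk (circleMap m b) := h
    obtain ⟨h1, h2⟩ := (circleMap_rel_iff n m a b).1 (QuotientAddGroup.eq.1 h')
    exact Prod.ext h1 ((Submodule.Quotient.eq _).2 h2)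
  · intro P
    obtain ⟨α, rfl⟩ := QuotientAddGroup.mk_surjective (s := constPhases s) P
    obtain ⟨α, n, a, h⟩ := α
    refine ⟨(n, Submodule.Quotient.mk a), ?_⟩
    show (QuotientAddGroup.mk (circleMap n a) : circleMaps s ⧸ constPhases s) = _
    congr 1
    apply Subtype.ext
    ext x
    induction x using QuotientAddGroup.induction_on with
    | H x => exact (circleMap_apply n a x).trans (h x).symm

/-- The phases are classified by the winding number and a class in `H^s(S¹; ℝ) / ℝ`. -/
def Phase.equiv (s : ℝ) : ℤ × SobModConst s ≃ Phase s := Equiv.ofBijective _ (Phase.mk_bijective s)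

/-- The space `K^s = Diff₀^s(S¹) ⓢ (H^{s-1}(S¹; S¹_{4π}) / S¹_{4π})`. -/
structure KS (s : ℝ) : Type where
  diffeo : Diff₀ s
  phase : Phase (s - 1)

namespace KS

variable {s : ℝ}

/-- The lift `φ : ℝ → ℝ` of the first component of `(φ, [α])`. -/
def phi (p : KS s) : ℝ → ℝ := p.diffeo.lift

/-- The identity `e = (id, [0])` of `K^s`. -/
def e (s : ℝ) : KS s := ⟨Diff₀.id s, 0⟩

/-- The winding number of the second component. -/
def winding (p : KS s) : ℤ := ((Phase.equiv (s - 1)).symm p.phase).1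

/-- The local coordinate `(id + h, [4πnx + a]) ↦ (h, [a])`. -/
def coord (p : KS s) : Model s := (p.diffeo.disp, ((Phase.equiv (s - 1)).symm p.phase).2)

open Classical in
/-- The inverse of the coordinate map on the component of winding number `n`. -/
def ofCoord (n : ℤ) (U : Model s) : KS s :=
  ⟨if h : U.1 ∈ diffSet s then ⟨U.1, h⟩ else Diff₀.id s, Phase.mk n U.2⟩

/-- `K^s` is the disjoint union, over the winding number, of copies of an open set of the model
space. -/
instance : TopologicalSpace (KS s) :=
  TopologicalSpace.induced (fun p => (p.winding, p.coord)) inferInstance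

theorem winding_ofCoord (n : ℤ) (U : Model s) : (ofCoord n U).winding = n :=
  congrArg Prod.fst ((Phase.equiv (s - 1)).symm_apply_apply (n, U.2))

theorem coord_ofCoord (n : ℤ) {U : Model s} (hU : U.1 ∈ diffSet s) : (ofCoord n U).coord = U := by
  have h := congrArg Prod.snd ((Phase.equiv (s - 1)).symm_apply_apply (n, U.2))
  have h2 : (ofCoord n U).coord.2 = U.2 := h
  refine Prod.ext ?_ h2
  simp [coord, ofCoord, hU]

theorem ofCoord_coord (p : KS s) : ofCoord p.winding p.coord = p := by
  have h1 : p.coord.1 ∈ diffSet s := p.diffeo.mem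
  have h2 : Phase.mk p.winding p.coord.2 = p.phase :=
    (Phase.equiv (s - 1)).apply_symm_apply p.phase
  unfold ofCoord
  rw [h2, dif_pos h1]
  rfl

/-- The chart of the component of winding number `n`. -/
def chart [hs : Fact (5 / 2 < s)] (n : ℤ) : OpenPartialHomeomorph (KS s) (Model s) where
  toFun := coord
  invFun := ofCoord n
  source := {p | p.winding = n}
  target := {U | U.1 ∈ diffSet s}
  map_source' := fun p _ => p.diffeo.mem
  map_target' := fun U _ => winding_ofCoord n U
  left_inv' := by
    rintro p rfl
    exact ofCoord_coord p
  right_inv' := fun U hU => coord_ofCoord n hU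
  open_source := (isOpen_discrete {n}).preimage (continuous_fst.comp continuous_induced_dom)
  open_target := (isOpen_diffSet (by have := hs.out; linarith)).preimage continuous_fst
  continuousOn_toFun := (continuous_snd.comp continuous_induced_dom).continuousOn
  continuousOn_invFun := by
    rw [continuousOn_iff_continuous_domRestrict, continuous_induced_rng]
    have he : (fun p : KS s => (p.winding, p.coord)) ∘
        Set.domRestrict {U : Model s | U.1 ∈ diffSet s} (ofCoord n) = fun U => (n, U.1) := by
      ext1 U
      exact Prod.ext (winding_ofCoord n U.1) (coord_ofCoord n U.2)
    rw [he]
    exact continuous_const.prodMk continuous_subtype_val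

instance [Fact (5 / 2 < s)] : ChartedSpace (Model s) (KS s) where
  atlas := range chart
  chartAt p := chart p.winding
  mem_chart_source _ := rfl
  chart_mem_atlas p := ⟨p.winding, rfl⟩

instance [Fact (5 / 2 < s)] (k : WithTop ℕ∞) : IsManifold 𝓘(ℝ, Model s) k (KS s) := by
  refine isManifold_of_contDiffOn 𝓘(ℝ, Model s) k (KS s) ?_
  rintro _ _ ⟨n, rfl⟩ ⟨m, rfl⟩
  refine contDiffOn_id.congr ?_
  rintro U ⟨hU, -⟩
  exact coord_ofCoord n hU.1

/-! ### The Kähler structure of `K^s`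

Every chart is a translate of `(φ, [α]) ↦ (φ - id, [α])`, so that every tangent space is the model
space `H₀^s(S¹; ℝ) × (H^{s-1}(S¹; ℝ) / ℝ)` and vector fields are maps from `K^s` to the model
space, with derivatives and Lie brackets computed as in a single chart. -/

/-- `π(U₂) = U₂ - ∫ U₂ φ_x dx`. -/
def proj (p : KS s) (ρ : SobModConst (s - 1)) : ℝ → ℝ :=
  fun x => ρ.rep x - ∫ y in (0 : ℝ)..1, ρ.rep y * deriv p.phi y

/-- The metric `⟨U, V⟩ = (1/4) ∫ (U₁ₓ V₁ₓ / φₓ + π(U₂) π(V₂) φₓ) dx`. -/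
def metric (p : KS s) (U V : Model s) : ℝ :=
  1 / 4 * ∫ x in (0 : ℝ)..1,
    (deriv (U.1 : Sob s).fn x * deriv (V.1 : Sob s).fn x / deriv p.phi x
      + p.proj U.2 x * p.proj V.2 x * deriv p.phi x)

/-- The complex structure `J(U₁, [U₂]) = (-∫₀ˣ π(U₂) φₓ dy, [U₁ₓ / φₓ])`. -/
def J (p : KS s) (U : Model s) : Model s :=
  (Sob₀.ofFun s (fun x => -∫ y in (0 : ℝ)..x, p.proj U.2 y * deriv p.phi y),
    Submodule.Quotient.mk
      (Sob.ofFun (s - 1) (fun x => deriv (U.1 : Sob s).fn x / deriv p.phi x)))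

/-- The two-form `ω(U, V) = (1/4) ∫ (U₂ₓ V₁ - V₂ₓ U₁) dx`, the same expression at every point. -/
def omega (_ : KS s) (U V : Model s) : ℝ :=
  1 / 4 * ∫ x in (0 : ℝ)..1,
    (deriv U.2.rep x * (V.1 : Sob s).fn x - deriv V.2.rep x * (U.1 : Sob s).fn x)

end KS

/-- The inverse of `A = -∂ₓ²` on functions of zero mean, with values in the functions vanishing at
`0`: `(A⁻¹ f)(x) = -∫₀ˣ ∫₀ʸ f(z) dz dy + x ∫₀¹ ∫₀ʸ f(z) dz dy`. -/
def invLap (f : ℝ → ℝ) : ℝ → ℝ := fun x =>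
  -(∫ y in (0 : ℝ)..x, ∫ z in (0 : ℝ)..y, f z) + x * ∫ y in (0 : ℝ)..1, ∫ z in (0 : ℝ)..y, f z

/-- Subtraction of the mean, `π(ρ) = ρ - ∫ ρ dx`. -/
def subMean (ρ : ℝ → ℝ) : ℝ → ℝ := fun x => ρ x - ∫ y in (0 : ℝ)..1, ρ y

/-- First component of the Christoffel map at the identity,
`-(1/2) A⁻¹ ∂ₓ (u₁ₓ v₁ₓ + π(u₂) π(v₂))`. -/
def christoffelOne (u₁ u₂ v₁ v₂ : ℝ → ℝ) : ℝ → ℝ := fun x =>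
  -(1 / 2) * invLap (deriv fun y => deriv u₁ y * deriv v₁ y + subMean u₂ y * subMean v₂ y) x

/-- A representative of the second component of the Christoffel map at the identity,
`-(1/2) [u₁ₓ π(v₂) + v₁ₓ π(u₂)]`. -/
def christoffelTwo (u₁ u₂ v₁ v₂ : ℝ → ℝ) : ℝ → ℝ := fun x =>
  -(1 / 2) * (deriv u₁ x * subMean v₂ x + deriv v₁ x * subMean u₂ x)

namespace KS

variable {s : ℝ}

/-- The Christoffel map of `K^s`, extended from the identity by right invariance:
`Γ_{(φ,[α])}(U, V) = Γ_e(U ∘ φ⁻¹, V ∘ φ⁻¹) ∘ φ`. -/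
def christoffel (p : KS s) (U V : Model s) : Model s :=
  let ψ : ℝ → ℝ := Function.invFun p.phi
  (Sob₀.ofFun s
      (christoffelOne ((U.1 : Sob s).fn ∘ ψ) (U.2.rep ∘ ψ) ((V.1 : Sob s).fn ∘ ψ) (V.2.rep ∘ ψ)
        ∘ p.phi),
    Submodule.Quotient.mk (Sob.ofFun (s - 1)
      (christoffelTwo ((U.1 : Sob s).fn ∘ ψ) (U.2.rep ∘ ψ) ((V.1 : Sob s).fn ∘ ψ) (V.2.rep ∘ ψ)
        ∘ p.phi)))

variable [Fact (5 / 2 < s)]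

/-- The directional derivative `DY · U` at `p` of a vector field `Y` on `K^s`. -/
def dirDeriv (Y : KS s → Model s) (p : KS s) (U : Model s) : Model s :=
  mfderiv 𝓘(ℝ, Model s) 𝓘(ℝ, Model s) Y p U

/-- The connection `∇_X Y = DY · X - Γ(Y, X)` of `K^s`. -/
def nabla (X Y : KS s → Model s) : KS s → Model s := fun p =>
  dirDeriv Y p (X p) - p.christoffel (Y p) (X p)

/-- The Lie bracket `[X, Y] = DY · X - DX · Y` of vector fields on `K^s`. -/
def bracket (X Y : KS s → Model s) : KS s → Model s := fun p =>
  dirDeriv Y p (X p) - dirDeriv X p (Y p)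

/-- `R(X, Y) Z = ∇_X ∇_Y Z - ∇_Y ∇_X Z - ∇_{[X, Y]} Z` for vector fields on `K^s`. -/
def curvatureField (X Y Z : KS s → Model s) : KS s → Model s :=
  nabla X (nabla Y Z) - nabla Y (nabla X Z) - nabla (bracket X Y) Z

/-- The curvature tensor `R_p(u, v) w`, computed by extending the tangent vectors `u, v, w` to the
vector fields that are constant in the chart. -/
def curvature (p : KS s) (u v w : Model s) : Model s :=
  curvatureField (fun _ => u) (fun _ => v) (fun _ => w) p

/-- The sectional curvature of the plane spanned by `u, v`. -/
def sec (p : KS s) (u v : Model s) : ℝ :=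
  p.metric (p.curvature u v v) u / (p.metric u u * p.metric v v - p.metric u v ^ 2)

end KS

end HunterSaxton

end

/-!
The curvature at `e` only involves the Christoffel map `Γ` near `e`, and there the composition with
`φ` and `φ⁻¹` in its definition can be removed. The change of variables `y = φ(x)` turns
`Γ_{(φ,[α])}(U, V)` into an expression (`localChristoffel`) built from `φₓ`, `1 / φₓ`, the
derivatives `U₁ₓ, V₁ₓ` and the zero mean parts of `U₂, V₂` by multiplication in `H^{s-1}`, mean
values, and one primitive `H^{s-1} → H₀^s`. As `s - 1 > 3/2`, the space `H^{s-1}` is a Banach algebra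
(up to a constant in the norm inequality), so this expression is differentiable in all its arguments
at `φ = id`. The only analysis needed is that `H^{s-1}` is complete and closed under products, and
that `F ∈ H^s` if and only if `F' ∈ H^{s-1}`; the continuity of multiplication, differentiation and
integration then follows from the closed graph theorem.

For smooth vector fields the second derivatives cancel by symmetry and the first derivatives cancel
algebraically, which leaves (`KS.curvatureField_e`)
`R(u, v) w = DΓ(v)(w, u) - DΓ(u)(w, v) + Γ(Γ(w, v), u) - Γ(Γ(w, u), v)`.
Writing `a = u₁ₓ`, `b = π(u₂)`, `c = v₁ₓ`, `d = π(v₂)`, the number `4 ⟨R(u, v) v, u⟩` is the mean of a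
polynomial in `a, b, c, d` and their quadratic means. All quartic monomials cancel
(`mean_curvature_contraction`), and what remains is the Gram determinant plus
`3/4 (∫ (ad - bc))²`, where `∫ (ad - bc) = 4 ω(u, v)` by an integration by parts.

Finally `J` is an isometry with `⟨Ju, u⟩ = 0` and `⟨Ju, v⟩ = ω(u, v)`, so that `ω(u, v)²` is at most
the Gram determinant; the defect is measured by the squared length of `KS.remainder u v`, the part of
`‖u‖² v` orthogonal to `u` and `Ju`, and the metric is positive definite.
-/
noncomputable section

open MeasureTheory

namespace HunterSaxton

/-! ### Products of Sobolev functions -/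

/-- Young's inequality `ℓ¹ * ℓ² ⊆ ℓ²`: the convolution is an absolutely convergent series of
translates of `y` in `ℓ²`. -/
theorem memℓp_convolution {a y : ℤ → ℝ} (ha : Summable fun k => |a k|) (hy : Memℓp y 2) :
    Memℓp (fun n => ∑' k, a k * y (n - k)) 2 ∧ ∀ n, Summable fun k => a k * y (n - k) := by
  have hy2 : Summable fun n => ‖y n‖ ^ (2 : ℝ) := by simpa using hy.summable (by norm_num)
  have hshift : ∀ k : ℤ, Memℓp (fun n => y (n - k)) 2 := fun k => by
    refine memℓp_gen ?_
    have := (Equiv.subRight k).summable_iff.2 hy2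
    simpa [Function.comp_def] using this
  let Y : ℤ → lp (fun _ : ℤ => ℝ) 2 := fun k => ⟨fun n => y (n - k), hshift k⟩
  have hnorm : ∀ k, ‖Y k‖ = ‖Y 0‖ := fun k => by
    rw [lp.norm_eq_tsum_rpow (by norm_num), lp.norm_eq_tsum_rpow (by norm_num)]
    congr 1
    have := (Equiv.subRight k).tsum_eq (fun n => ‖y n‖ ^ (2 : ℝ))
    simpa [Y] using this
  have hs : Summable fun k => a k • Y k := by
    refine Summable.of_norm ?_
    simp only [norm_smul, hnorm, Real.norm_eq_abs]
    exact ha.mul_right _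
  have hcoord : ∀ n, HasSum (fun k => a k * y (n - k))
      ((∑' k, a k • Y k : lp (fun _ : ℤ => ℝ) 2) n) :=
    fun n => by
      have h := (lp.evalCLM ℝ (fun _ : ℤ => ℝ) 2 n).hasSum hs.hasSum
      exact h
  refine ⟨?_, fun n => (hcoord n).summable⟩
  have he : (fun n => ∑' k, a k * y (n - k)) = (∑' k, a k • Y k : lp (fun _ : ℤ => ℝ) 2) :=
    funext fun n => (hcoord n).tsum_eq
  rw [he]
  exact lp.memℓp _

/-- Peetre's inequality: the weight of `n` is controlled by those of `k` and `n - k`. -/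
theorem weight_le_add {s : ℝ} (hs : 0 ≤ s) (n k : ℤ) :
    weight s n ≤ 4 ^ (s / 2) * (weight s k + weight s (n - k)) := by
  have hle : ∀ {x y z : ℝ}, 0 ≤ x → 1 + x ≤ 4 * (1 + y) → 0 ≤ y → 0 ≤ z →
      (1 + x) ^ (s / 2) ≤ 4 ^ (s / 2) * ((1 + y) ^ (s / 2) + (1 + z) ^ (s / 2)) := by
    intro x y z hx hxy hy hz
    calc (1 + x) ^ (s / 2) ≤ (4 * (1 + y)) ^ (s / 2) :=
          Real.rpow_le_rpow (by positivity) hxy (by positivity)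
      _ = 4 ^ (s / 2) * (1 + y) ^ (s / 2) := Real.mul_rpow (by norm_num) (by positivity)
      _ ≤ _ := by
        gcongr
        have : 0 ≤ (1 + z) ^ (s / 2) := by positivity
        linarith
  have h : (n : ℝ) = k + ((n - k : ℤ) : ℝ) := by push_cast; ring
  unfold weight
  rw [h]
  generalize (k : ℝ) = y
  generalize ((n - k : ℤ) : ℝ) = z
  rcases le_total (y ^ 2) (z ^ 2) with h1 | h1
  · rw [add_comm ((1 + y ^ 2) ^ (s / 2))]
    exact hle (sq_nonneg _) (by nlinarith [sq_nonneg (y - z)]) (sq_nonneg _) (sq_nonneg _)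
  · exact hle (sq_nonneg _) (by nlinarith [sq_nonneg (y - z)]) (sq_nonneg _) (sq_nonneg _)

/-- The Fourier coefficients of a product are the convolution of the Fourier coefficients. -/
theorem hasSum_coeff_mul {f g : C(UnitAddCircle, ℝ)} (hf : Summable fun k => ‖coeff f k‖) (n : ℤ) :
    HasSum (fun k => coeff f k * coeff g (n - k)) (coeff (f * g) n) := by
  have hsum : HasSum (fun k => coeff f k • fourier k) (toComplex f) :=
    hasSum_fourier_series_of_summable (f := toComplex f) hf.of_norm
  have h := hasSum_integral_of_summable_integral_norm (μ := AddCircle.haarAddCircle (T := (1 : ℝ)))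
    (F := fun k x => coeff f k * (fourier (-(n - k)) x * ((g x : ℝ) : ℂ))) (fun k => ?_) ?_
  · have e1 : ∀ k, ∫ x, coeff f k * (fourier (-(n - k)) x * ((g x : ℝ) : ℂ))
        ∂(AddCircle.haarAddCircle (T := (1 : ℝ))) = coeff f k * coeff g (n - k) := fun k => by
      rw [integral_const_mul]
      simp [coeff, fourierCoeff]
    simp only [e1] at h
    convert! h using 1
    unfold coeff
    unfold fourierCoeff
    refine integral_congr_ae (Filter.Eventually.of_forall fun x => ?_)
    have h2 := (ContinuousMap.evalCLM ℂ x).hasSum hsum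
    have h3 := (h2.mul_right (fourier (-n) x * ((g x : ℝ) : ℂ))).tsum_eq
    simp only [smul_eq_mul]
    refine Eq.trans ?_ (h3.symm.trans (tsum_congr fun k => ?_))
    · simp [toComplex]; ring
    · have : (-(n - k)) = k + -n := by ring
      simp only [this, fourier_add]
      change coeff f k * fourier k x * (fourier (-n) x * ((g x : ℝ) : ℂ))
        = coeff f k * (fourier k x * fourier (-n) x * ((g x : ℝ) : ℂ))
      ring
  · refine Integrable.const_mul ?_ _
    refine Continuous.integrable_of_hasCompactSupport ?_ (HasCompactSupport.of_compactSpace _)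
    exact (fourier _).continuous.mul (Complex.continuous_ofReal.comp g.continuous)
  · refine Summable.of_nonneg_of_le (fun k => integral_nonneg fun x => norm_nonneg _) (fun k => ?_)
      (hf.mul_right ‖g‖)
    have := norm_integral_le_of_norm_le_const (μ := AddCircle.haarAddCircle (T := (1 : ℝ)))
      (f := fun x => ‖coeff f k * (fourier (-(n - k)) x * ((g x : ℝ) : ℂ))‖)
      (C := ‖coeff f k‖ * ‖g‖)
      (Filter.Eventually.of_forall fun x => by
        have h1 : ‖fourier (-(n - k)) x‖ = 1 := Circle.norm_coe _
        have h2 := g.norm_coe_le_norm x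
        rw [norm_norm, norm_mul, norm_mul, h1, one_mul, Complex.norm_real]
        gcongr)
    simp only [probReal_univ, mul_one] at this
    exact (Real.le_norm_self _).trans this

theorem Sob.summable_coeff {r : ℝ} (hr : 3 / 2 < r) (f : Sob r) :
    Summable fun n => ‖coeff f.toCont n‖ := by
  obtain ⟨C, -, hC⟩ := Sob.exists_bound hr
  refine Summable.of_nonneg_of_le (fun n => norm_nonneg _) (fun n => ?_) (hC f).1
  nlinarith [norm_nonneg (coeff f.toCont n), abs_nonneg (n : ℝ)]

theorem Sob.memℓp_norm {r : ℝ} (f : Sob r) :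
    Memℓp (fun n => weight r n * ‖coeff f.toCont n‖) 2 := by
  have h : Memℓp (fun n : ℤ => (weight r n : ℂ) * coeff f.toCont n) 2 := f.2
  have := h.norm
  simpa [abs_of_pos (weight_pos r _)] using this

/-- `H^r` is closed under multiplication: the weight is split between the two factors by
`weight_le_add`, and each half is a convolution of an `ℓ¹` and an `ℓ²` sequence. -/
theorem mul_mem_sobolev {r : ℝ} (hr : 3 / 2 < r) (f g : Sob r) :
    f.toCont * g.toCont ∈ sobolevSubmodule r := by
  obtain ⟨h1, h1'⟩ := memℓp_convolution (a := fun n => ‖coeff f.toCont n‖)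
    (by simpa using f.summable_coeff hr) g.memℓp_norm
  obtain ⟨h2, h2'⟩ := memℓp_convolution (a := fun n => ‖coeff g.toCont n‖)
    (by simpa using g.summable_coeff hr) f.memℓp_norm
  refine ((h1.add h2).const_smul ((4 : ℝ) ^ (r / 2))).mono fun n => ?_
  have hw := weight_pos r n
  have hf := f.summable_coeff hr
  have e2 : ∑' k, ‖coeff g.toCont k‖ * (weight r (n - k) * ‖coeff f.toCont (n - k)‖)
      = ∑' k, weight r k * ‖coeff f.toCont k‖ * ‖coeff g.toCont (n - k)‖ := by
    rw [← (Equiv.subLeft n).tsum_eq]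
    refine tsum_congr fun k => ?_
    simp only [Equiv.subLeft_apply, sub_sub_cancel]
    ring
  have s2 : Summable fun k => weight r k * ‖coeff f.toCont k‖ * ‖coeff g.toCont (n - k)‖ := by
    rw [← (Equiv.subLeft n).summable_iff]
    convert! h2' n using 2 with k
    simp only [Function.comp_apply, Equiv.subLeft_apply, sub_sub_cancel]
    ring
  have hs := ((s2.add (h1' n)).mul_left (4 ^ (r / 2)))
  have hb : ∀ k, ‖(weight r n : ℂ) * (coeff f.toCont k * coeff g.toCont (n - k))‖ ≤
      4 ^ (r / 2) * (weight r k * ‖coeff f.toCont k‖ * ‖coeff g.toCont (n - k)‖ +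
        ‖coeff f.toCont k‖ * (weight r (n - k) * ‖coeff g.toCont (n - k)‖)) := fun k => by
    rw [norm_mul, norm_mul, Complex.norm_real, Real.norm_of_nonneg hw.le]
    calc _ ≤ 4 ^ (r / 2) * (weight r k + weight r (n - k)) *
          (‖coeff f.toCont k‖ * ‖coeff g.toCont (n - k)‖) := by
          gcongr
          exact weight_le_add (by linarith) n k
      _ = _ := by ring
  have h := ((hasSum_coeff_mul (g := g.toCont) hf n).mul_left (weight r n : ℂ)).tsum_eq
  rw [← h]
  refine (tsum_of_norm_bounded hs.hasSum hb).trans ?_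
  rw [tsum_mul_left, s2.tsum_add (h1' n), Pi.smul_apply, Pi.add_apply, e2, add_comm]
  rfl

/-! ### Pointwise evaluation and completeness -/

/-- A continuous function satisfying the Sobolev condition, as an element of `H^r`. -/
def Sob.mk {r : ℝ} (f : C(UnitAddCircle, ℝ)) (hf : f ∈ sobolevSubmodule r) : Sob r := ⟨f, hf⟩

theorem Sob.ext_fn {r : ℝ} {f g : Sob r} (h : ∀ x, f.fn x = g.fn x) : f = g := by
  apply Subtype.ext
  refine ContinuousMap.ext fun x => ?_
  induction x using QuotientAddGroup.induction_on with
  | H x => exact h x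

section fn

variable {r : ℝ} (f g : Sob r) (c x : ℝ)

@[simp] theorem Sob.fn_add : (f + g).fn x = f.fn x + g.fn x := by simp [Sob.fn]
@[simp] theorem Sob.fn_sub : (f - g).fn x = f.fn x - g.fn x := by simp [Sob.fn]
@[simp] theorem Sob.fn_neg : (-f).fn x = -f.fn x := by simp [Sob.fn]
@[simp] theorem Sob.fn_smul : (c • f).fn x = c * f.fn x := by simp [Sob.fn]
@[simp] theorem Sob.fn_zero : (0 : Sob r).fn x = 0 := by simp [Sob.fn]
@[simp] theorem Sob.fn_one : (Sob.one r).fn x = 1 := rfl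

theorem Sob.continuous_fn : Continuous f.fn :=
  f.toCont.continuous.comp (AddCircle.continuous_mk' 1)

end fn

theorem Sob.exists_norm_toCont_le {r : ℝ} (hr : 3 / 2 < r) :
    ∃ C : ℝ, ∀ f : Sob r, ‖f.toCont‖ ≤ C * ‖f‖ := by
  obtain ⟨C, hC0, hC⟩ := Sob.exists_bound hr
  refine ⟨C, fun f => ?_⟩
  rw [ContinuousMap.norm_le _ (mul_nonneg hC0 (norm_nonneg _))]
  intro x
  have hs := f.summable_coeff hr
  have h := has_pointwise_sum_fourier_series_of_summable (f := toComplex f.toCont)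
    (Summable.of_norm hs) x
  have h2 : ‖((f.toCont x : ℝ) : ℂ)‖ ≤ ∑' n : ℤ, (1 + |(n : ℝ)|) * ‖coeff f.toCont n‖ := by
    have h3 : toComplex f.toCont x = ((f.toCont x : ℝ) : ℂ) := rfl
    rw [← h3, ← h.tsum_eq]
    refine tsum_of_norm_bounded (hC f).1.hasSum fun n => ?_
    have h1 : ‖fourier n x‖ = 1 := Circle.norm_coe _
    rw [norm_smul, h1, mul_one]
    change ‖coeff f.toCont n‖ ≤ _
    nlinarith [norm_nonneg (coeff f.toCont n), abs_nonneg (n : ℝ)]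
  rw [Complex.norm_real] at h2
  exact h2.trans (hC f).2

section complete

variable {r : ℝ} [hr : Fact (3 / 2 < r)]

/-- The inclusion of `H^r` into the continuous functions. -/
def Sob.toContL : Sob r →L[ℝ] C(UnitAddCircle, ℝ) :=
  LinearMap.mkContinuousOfExistsBound Sob.toCont (Sob.exists_norm_toCont_le hr.out)

theorem Sob.tendsto_fn {ι : Type*} {l : Filter ι} {u : ι → Sob r} {f : Sob r}
    (h : Filter.Tendsto u l (𝓝 f)) (x : ℝ) : Filter.Tendsto (fun i => (u i).fn x) l (𝓝 (f.fn x)) :=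
  ((ContinuousMap.evalCLM ℝ (x : UnitAddCircle)).continuous.comp
    (Sob.toContL (r := r)).continuous).continuousAt.tendsto.comp h

theorem norm_coeff_le (f : C(UnitAddCircle, ℝ)) (n : ℤ) : ‖coeff f n‖ ≤ ‖f‖ := by
  have := norm_integral_le_of_norm_le_const (μ := AddCircle.haarAddCircle (T := (1 : ℝ)))
      (f := fun x => fourier (-n) x • ((f x : ℝ) : ℂ)) (C := ‖f‖)
      (Filter.Eventually.of_forall fun x => by
        have h1 : ‖fourier (-n) x‖ = 1 := Circle.norm_coe _
        rw [norm_smul, h1, one_mul, Complex.norm_real]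
        exact f.norm_coe_le_norm x)
  simpa [coeff, fourierCoeff] using this

theorem continuous_coeff (n : ℤ) : Continuous fun f : C(UnitAddCircle, ℝ) => coeff f n := by
  refine (AddMonoidHomClass.lipschitz_of_bound
    (AddMonoidHom.mk' (fun f : C(UnitAddCircle, ℝ) => coeff f n) fun f g => coeff_add f g n) 1
    fun f => ?_).continuous
  simpa using norm_coeff_le f n

/-- A Cauchy sequence converges uniformly, and the weighted coefficients of the uniform limit are
the limit in `ℓ²`. -/
instance : CompleteSpace (Sob r) := by
  refine Metric.complete_of_cauchySeq_tendsto fun u hu => ?_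
  have hiso : Isometry (Sob.toL2 r) := AddMonoidHomClass.isometry_of_norm _ fun f => rfl
  obtain ⟨y, hy⟩ := cauchySeq_tendsto_of_complete (hiso.uniformContinuous.comp_cauchySeq hu)
  obtain ⟨f, hf⟩ := cauchySeq_tendsto_of_complete
    ((Sob.toContL (r := r)).uniformContinuous.comp_cauchySeq hu)
  have hyf : ∀ n, y n = (weight r n : ℂ) * coeff f n := fun n => by
    have h1 := ((lp.evalCLM ℝ (fun _ : ℤ => ℂ) 2 n).continuous.tendsto y).comp hy
    have h2 := (((continuous_coeff n).tendsto f).comp hf).const_mul (weight r n : ℂ)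
    exact tendsto_nhds_unique h1 h2
  have hmem : f ∈ sobolevSubmodule r := by
    show Memℓp (fun n : ℤ => (weight r n : ℂ) * coeff f n) 2
    rw [← funext hyf]
    exact lp.memℓp y
  refine ⟨Sob.mk f hmem, ?_⟩
  rw [hiso.isEmbedding.tendsto_nhds_iff]
  convert! hy using 2
  ext n
  exact (hyf n).symm

instance (s : ℝ) [Fact (3 / 2 < s)] : CompleteSpace (Sob₀ s) := by
  have h : IsClosed (Sob₀ s : Set (Sob s)) := by
    have hc : Continuous fun f : Sob s => f.fn 0 :=
      continuous_iff_continuousAt.2 fun f => Sob.tendsto_fn Filter.tendsto_id 0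
    exact isClosed_singleton.preimage hc
  exact h.completeSpace_coe

end complete

/-! ### Multiplication, mean value and zero mean part as continuous linear maps -/

section algebra

variable {r : ℝ} [hr : Fact (3 / 2 < r)]

instance : Mul (Sob r) := ⟨fun f g => Sob.mk (f.toCont * g.toCont) (mul_mem_sobolev hr.out f g)⟩

@[simp] theorem Sob.fn_mul (f g : Sob r) (x : ℝ) : (f * g).fn x = f.fn x * g.fn x := rfl

/-- Multiplication by an element of `H^r`; continuity is the closed graph theorem. -/
def Sob.mulLeftL (f : Sob r) : Sob r →L[ℝ] Sob r :=
  ContinuousLinearMap.ofSeqClosedGraph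
    (g := { toFun := fun g => f * g
            map_add' := fun g h => Sob.ext_fn fun x => by simp; ring
            map_smul' := fun c g => Sob.ext_fn fun x => by simp; ring })
    fun u g k hu hk => Sob.ext_fn fun x =>
      tendsto_nhds_unique (Sob.tendsto_fn hk x) ((Sob.tendsto_fn hu x).const_mul (f.fn x))

/-- Multiplication in `H^r` as a continuous bilinear map, again by the closed graph theorem. -/
def Sob.mulL : Sob r →L[ℝ] Sob r →L[ℝ] Sob r :=
  ContinuousLinearMap.ofSeqClosedGraph
    (g := { toFun := Sob.mulLeftL
            map_add' := fun f h => by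
              ext g : 1
              exact Sob.ext_fn fun x => by simp [Sob.mulLeftL]; ring
            map_smul' := fun c f => by
              ext g : 1
              exact Sob.ext_fn fun x => by simp [Sob.mulLeftL]; ring })
    fun u f T hu hT => by
      ext g : 1
      refine Sob.ext_fn fun x => ?_
      have h := Sob.tendsto_fn
        (((ContinuousLinearMap.apply ℝ (Sob r) g).continuous.tendsto T).comp hT) x
      exact tendsto_nhds_unique h ((Sob.tendsto_fn hu x).mul_const (g.fn x))

theorem Sob.mulL_apply (f g : Sob r) : Sob.mulL f g = f * g := rfl

/-- The mean value `∫ f dx`. -/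
def Sob.mean : Sob r →L[ℝ] ℝ :=
  LinearMap.mkContinuousOfExistsBound
    { toFun := fun f => ∫ x in (0 : ℝ)..1, f.fn x
      map_add' := fun f g => by
        simp only [Sob.fn_add]
        exact intervalIntegral.integral_add (f.continuous_fn.intervalIntegrable _ _)
          (g.continuous_fn.intervalIntegrable _ _)
      map_smul' := fun c f => by simp }
    (by
      obtain ⟨C, hC⟩ := Sob.exists_norm_toCont_le hr.out
      refine ⟨C, fun f => ?_⟩
      have h := intervalIntegral.norm_integral_le_of_norm_le_const (a := 0) (b := 1) (f := f.fn)
        (C := C * ‖f‖) fun x _ => (f.toCont.norm_coe_le_norm _).trans (hC f)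
      simpa using h)

theorem Sob.mean_apply (f : Sob r) : Sob.mean f = ∫ x in (0 : ℝ)..1, f.fn x := rfl

@[simp] theorem Sob.mean_one : Sob.mean (Sob.one r) = 1 := by simp [Sob.mean_apply]

/-- The projection `ρ ↦ ρ - ∫ ρ dx` onto the functions of zero mean. -/
def Sob.piL : Sob r →L[ℝ] Sob r := ContinuousLinearMap.id ℝ _ - Sob.mean.smulRight (Sob.one r)

theorem Sob.piL_apply (f : Sob r) : Sob.piL f = f - Sob.mean f • Sob.one r := rfl

@[simp] theorem Sob.mean_piL (f : Sob r) : Sob.mean (Sob.piL f) = 0 := by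
  simp [Sob.piL_apply]

/-- The representative of zero mean of a class in `H^r / ℝ`. -/
def SobModConst.piL : SobModConst r →L[ℝ] Sob r :=
  (Sob.consts r).liftQL Sob.piL (by
    unfold Sob.consts
    rw [Submodule.span_singleton_le_iff_mem]
    show Sob.piL (Sob.one r) = 0
    simp [Sob.piL_apply])

@[simp] theorem SobModConst.piL_mk (f : Sob r) :
    SobModConst.piL (Submodule.Quotient.mk f : SobModConst r) = f - Sob.mean f • Sob.one r := rfl

theorem SobModConst.piL_mkQL (f : Sob r) :
    SobModConst.piL ((Sob.consts r).mkQL f) = f - Sob.mean f • Sob.one r := rfl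

@[simp] theorem SobModConst.mean_piL (ρ : SobModConst r) : Sob.mean ρ.piL = 0 := by
  obtain ⟨f, rfl⟩ := Submodule.Quotient.mk_surjective _ ρ
  simp

theorem SobModConst.piL_injective : Function.Injective (SobModConst.piL (r := r)) := by
  rw [injective_iff_map_eq_zero]
  intro ρ h
  obtain ⟨f, rfl⟩ := Submodule.Quotient.mk_surjective _ ρ
  rw [Submodule.Quotient.mk_eq_zero]
  rw [SobModConst.piL_mk, sub_eq_zero] at h
  rw [h]
  exact Submodule.smul_mem _ _ (Submodule.mem_span_singleton_self _)

/-- Any representative differs from the one of zero mean by its mean value. -/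
theorem SobModConst.exists_fn_eq_rep (ρ : SobModConst r) :
    ∃ f : Sob r, f.fn = ρ.rep ∧ f = ρ.piL + Sob.mean f • Sob.one r := by
  refine ⟨_, rfl, ?_⟩
  have h := Function.surjInv_eq (Submodule.mkQ_surjective (Sob.consts r)) ρ
  set f := Function.surjInv (Submodule.mkQ_surjective (Sob.consts r)) ρ
  rw [← h]
  change f = (f - Sob.mean f • Sob.one r) + _
  abel

end algebra

/-! ### Derivatives and primitives -/

/-- A continuous `1`-periodic function as a function on the circle. -/
def periodicLift (f : ℝ → ℝ) (hp : Function.Periodic f 1) (hc : Continuous f) :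
    C(UnitAddCircle, ℝ) := ⟨hp.lift, continuous_coinduced_dom.2 hc⟩

/-- Integration by parts. Both sides also vanish for `n = 0`, but this is not needed. -/
theorem coeff_of_hasDerivAt {F f : C(UnitAddCircle, ℝ)}
    (h : ∀ x : ℝ, HasDerivAt (fun x : ℝ => F (x : UnitAddCircle)) (f (x : UnitAddCircle)) x)
    {n : ℤ} (hn : n ≠ 0) : coeff f n = 2 * Real.pi * Complex.I * n * coeff F n := by
  have e : ∀ g : C(UnitAddCircle, ℝ), coeff g n
      = fourierCoeffOn (lt_add_of_pos_right (0 : ℝ) one_pos)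
        (fun x : ℝ => ((g (x : UnitAddCircle) : ℝ) : ℂ)) n := fun g => by
    rw [← fourierCoeff_liftIco_eq (T := 1)]
    unfold coeff
    congr 1
    ext x
    exact congrArg (fun y => ((g y : ℝ) : ℂ)) ((AddCircle.equivIco 1 0).symm_apply_apply x).symm
  have hc : Continuous fun x : ℝ => ((f (x : UnitAddCircle) : ℝ) : ℂ) :=
    Complex.continuous_ofReal.comp (f.continuous.comp (AddCircle.continuous_mk' 1))
  have hd := fourierCoeffOn_of_hasDerivAt (lt_add_of_pos_right (0 : ℝ) one_pos) hn
    (fun x _ => (h x).ofReal_comp) (hc.intervalIntegrable _ _)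
  rw [e f, e F, hd]
  have h1 : (((0 : ℝ) + 1 : ℝ) : UnitAddCircle) = ((0 : ℝ) : UnitAddCircle) := by
    rw [AddCircle.coe_add_period]
  rw [h1]
  have hn' : (n : ℂ) ≠ 0 := by exact_mod_cast hn
  have hpi : (Real.pi : ℂ) ≠ 0 := by exact_mod_cast Real.pi_ne_zero
  field_simp
  simp

theorem weight_sub_one (s : ℝ) (n : ℤ) :
    weight s n = (1 + (n : ℝ) ^ 2) ^ (1 / 2 : ℝ) * weight (s - 1) n := by
  unfold weight
  rw [← Real.rpow_add (by positivity)]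
  congr 1
  ring

/-- A `C¹` function is of class `H^s` if and only if its derivative is of class `H^{s-1}`. -/
theorem mem_sobolev_iff_of_hasDerivAt (s : ℝ) {F f : C(UnitAddCircle, ℝ)}
    (h : ∀ x : ℝ, HasDerivAt (fun x : ℝ => F (x : UnitAddCircle)) (f (x : UnitAddCircle)) x) :
    F ∈ sobolevSubmodule s ↔ f ∈ sobolevSubmodule (s - 1) := by
  have hiff : ∀ (s : ℝ) (g : C(UnitAddCircle, ℝ)), g ∈ sobolevSubmodule s ↔
      Summable fun n : ℤ => (weight s n * ‖coeff g n‖) ^ 2 := fun s g => by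
    change Memℓp (fun n : ℤ => (weight s n : ℂ) * coeff g n) 2 ↔ _
    rw [memℓp_gen_iff (by norm_num)]
    simp [abs_of_pos (weight_pos s _)]
  have hcf : ∀ n : ℤ, n ≠ 0 → ‖coeff f n‖ = 2 * Real.pi * |(n : ℝ)| * ‖coeff F n‖ := fun n hn => by
    rw [coeff_of_hasDerivAt h hn]
    simp [abs_of_pos Real.pi_pos]
  have hfin : ({0} : Set ℤ).Finite := finite_singleton 0
  rw [hiff, hiff]
  have hsq : ∀ n : ℤ, ((1 + (n : ℝ) ^ 2) ^ (1 / 2 : ℝ)) ^ 2 = 1 + (n : ℝ) ^ 2 := fun n => by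
    rw [← Real.sqrt_eq_rpow, Real.sq_sqrt (by positivity)]
  constructor
  · intro hF
    refine Summable.of_norm_bounded_eventually (hF.mul_left ((2 * Real.pi) ^ 2)) ?_
    filter_upwards [hfin.compl_mem_cofinite] with n hn
    have hn0 : n ≠ 0 := by simpa using hn
    rw [Real.norm_of_nonneg (sq_nonneg _), hcf n hn0, weight_sub_one s]
    simp only [mul_pow, hsq, sq_abs]
    have : 0 ≤ 2 ^ 2 * Real.pi ^ 2 * (weight (s - 1) n ^ 2 * ‖coeff F n‖ ^ 2) := by positivity
    nlinarith
  · intro hf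
    refine Summable.of_norm_bounded_eventually hf ?_
    filter_upwards [hfin.compl_mem_cofinite] with n hn
    have hn0 : n ≠ 0 := by simpa using hn
    rw [Real.norm_of_nonneg (sq_nonneg _), hcf n hn0, weight_sub_one s]
    simp only [mul_pow, hsq, sq_abs]
    have h1 : (1 : ℝ) ≤ (n : ℝ) ^ 2 := by
      have : (1 : ℤ) ≤ n ^ 2 := by have := sq_pos_of_ne_zero hn0; omega
      exact_mod_cast this
    have h2 : (9 : ℝ) ≤ Real.pi ^ 2 := by nlinarith [Real.pi_gt_three]
    have h3 : 1 + (n : ℝ) ^ 2 ≤ 2 ^ 2 * Real.pi ^ 2 * (n : ℝ) ^ 2 := by nlinarith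
    have h4 : 0 ≤ weight (s - 1) n ^ 2 * ‖coeff F n‖ ^ 2 := by positivity
    nlinarith

instance (s : ℝ) [h : Fact (5 / 2 < s)] : Fact (3 / 2 < s) := ⟨by have := h.out; linarith⟩
instance (s : ℝ) [h : Fact (5 / 2 < s)] : Fact (3 / 2 < s - 1) := ⟨by have := h.out; linarith⟩

section deriv

theorem Sob.deriv_periodic {s : ℝ} (f : Sob s) : Function.Periodic (deriv f.fn) 1 := fun x => by
  rw [← deriv_comp_add_const]
  congr 1
  exact funext fun y => Sob.fn_add_one _ y

theorem Sob₀.fn_zero {s : ℝ} (f : Sob₀ s) : (f : Sob s).fn 0 = 0 := f.2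

theorem Sob.hasDerivAt_integral {r : ℝ} (f : Sob r) (x : ℝ) :
    HasDerivAt (fun x => ∫ y in (0 : ℝ)..x, f.fn y) (f.fn x) x :=
  intervalIntegral.integral_hasDerivAt_right (f.continuous_fn.intervalIntegrable _ _)
    (f.continuous_fn.stronglyMeasurableAtFilter _ _) f.continuous_fn.continuousAt

variable {s : ℝ} [hs : Fact (3 / 2 < s)]

theorem Sob.hasDerivAt_fn (f : Sob s) (x : ℝ) : HasDerivAt f.fn (deriv f.fn x) x :=
  Sob.hasDerivAt hs.out f x

/-- The derivative of an element of `H^s`, as a continuous function on the circle. -/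
def Sob.derivCont (f : Sob s) : C(UnitAddCircle, ℝ) :=
  periodicLift (deriv f.fn) f.deriv_periodic (Sob.continuous_deriv hs.out f)

theorem Sob.derivCont_mem (f : Sob s) : f.derivCont ∈ sobolevSubmodule (s - 1) :=
  (mem_sobolev_iff_of_hasDerivAt s fun x => f.hasDerivAt_fn x).1 f.2

end deriv

section operators

variable {s : ℝ} [hs : Fact (5 / 2 < s)]

/-- The derivative `∂ₓ : H^s → H^{s-1}`. -/
def Sob.derivL : Sob s →L[ℝ] Sob (s - 1) :=
  ContinuousLinearMap.ofSeqClosedGraph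
    (g := { toFun := fun f => Sob.mk f.derivCont f.derivCont_mem
            map_add' := fun f g => Sob.ext_fn fun x => by
              rw [Sob.fn_add]
              change deriv (f + g).fn x = deriv f.fn x + deriv g.fn x
              rw [show (f + g).fn = f.fn + g.fn from funext fun y => Sob.fn_add f g y]
              exact ((f.hasDerivAt_fn x).add (g.hasDerivAt_fn x)).deriv
            map_smul' := fun c f => Sob.ext_fn fun x => by
              rw [Sob.fn_smul]
              change deriv (c • f).fn x = c * deriv f.fn x
              rw [show (c • f).fn = fun y => c * f.fn y from funext fun y => Sob.fn_smul f c y]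
              exact ((f.hasDerivAt_fn x).const_mul c).deriv })
    fun u f g hu hg => Sob.ext_fn fun x => by
      refine tendsto_nhds_unique (Sob.tendsto_fn hg x) ?_
      change Filter.Tendsto (fun i => deriv (u i).fn x) _ (𝓝 (deriv f.fn x))
      obtain ⟨C, -, hC⟩ := Sob.exists_deriv_bound (s := s) (Fact.out : 3 / 2 < s)
      rw [tendsto_iff_norm_sub_tendsto_zero] at hu ⊢
      refine squeeze_zero (fun _ => norm_nonneg _) (fun i => ?_) (by simpa using hu.const_mul C)
      have h : deriv (u i - f).fn x = deriv (u i).fn x - deriv f.fn x := by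
        rw [show (u i - f).fn = (u i).fn - f.fn from funext fun y => Sob.fn_sub (u i) f y]
        exact (((u i).hasDerivAt_fn x).sub (f.hasDerivAt_fn x)).deriv
      rw [← h]
      exact hC _ x

@[simp] theorem Sob.fn_derivL (f : Sob s) (x : ℝ) : (Sob.derivL f).fn x = deriv f.fn x := rfl

@[simp] theorem Sob.mean_derivL (f : Sob s) : Sob.mean (Sob.derivL f) = 0 := by
  rw [Sob.mean_apply]
  simp only [Sob.fn_derivL]
  rw [intervalIntegral.integral_eq_sub_of_hasDerivAt (fun x _ => f.hasDerivAt_fn x)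
    ((Sob.continuous_deriv Fact.out f).intervalIntegrable _ _)]
  simpa [sub_eq_zero] using f.fn_add_one 0

/-- The derivative `∂ₓ : H₀^s → H^{s-1}`. -/
def Sob₀.derivL : Sob₀ s →L[ℝ] Sob (s - 1) := Sob.derivL.comp (Sob₀ s).subtypeL

@[simp] theorem Sob₀.fn_derivL (f : Sob₀ s) (x : ℝ) :
    (Sob₀.derivL f).fn x = deriv (f : Sob s).fn x := rfl

@[simp] theorem Sob₀.mean_derivL (f : Sob₀ s) : Sob.mean (Sob₀.derivL f) = 0 :=
  Sob.mean_derivL _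

theorem Sob₀.derivL_injective : Function.Injective (Sob₀.derivL (s := s)) := by
  rw [injective_iff_map_eq_zero]
  intro f h
  refine Subtype.ext (Sob.ext_fn fun x => ?_)
  have hd : ∀ y, deriv (f : Sob s).fn y = 0 := fun y => by
    rw [← Sob₀.fn_derivL f y, h, Sob.fn_zero]
  rw [is_const_of_deriv_eq_zero (fun y => ((f : Sob s).hasDerivAt_fn y).differentiableAt) hd x 0,
    Sob₀.fn_zero f]
  exact (Sob.fn_zero x).symm

theorem Sob.hasDerivAt_prim (f : Sob (s - 1)) (x : ℝ) :
    HasDerivAt (fun x => (∫ y in (0 : ℝ)..x, f.fn y) - x * Sob.mean f) ((Sob.piL f).fn x) x := by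
  convert! (f.hasDerivAt_integral x).sub ((hasDerivAt_id x).mul_const (Sob.mean f)) using 1
  simp [Sob.piL_apply]

theorem Sob.prim_periodic (f : Sob (s - 1)) :
    Function.Periodic (fun x => (∫ y in (0 : ℝ)..x, f.fn y) - x * Sob.mean f) 1 := fun x => by
  have hp : Function.Periodic f.fn 1 := f.fn_add_one
  have h := hp.intervalIntegral_add_eq_add 0 x fun _ _ => f.continuous_fn.intervalIntegrable _ _
  simp only [zero_add] at h
  simp only [h, Sob.mean_apply]
  ring

/-- The primitive `∫₀ˣ f dy - x ∫ f dy` of the zero mean part of `f`. -/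
def Sob.prim (f : Sob (s - 1)) : Sob₀ s :=
  ⟨Sob.mk (periodicLift _ f.prim_periodic
      (continuous_iff_continuousAt.2 fun x => (f.hasDerivAt_prim x).continuousAt))
    ((mem_sobolev_iff_of_hasDerivAt s (f := (Sob.piL f).toCont) fun x => f.hasDerivAt_prim x).2
      (Sob.piL f).2), by
    show (∫ y in (0 : ℝ)..0, f.fn y) - 0 * Sob.mean f = 0
    simp⟩

theorem Sob.derivL_prim (f : Sob (s - 1)) : Sob₀.derivL f.prim = Sob.piL f :=
  Sob.ext_fn fun x => (f.hasDerivAt_prim x).deriv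

/-- The primitive as a continuous linear map; it is the inverse of the derivative on functions of
zero mean. -/
def Sob.primL : Sob (s - 1) →L[ℝ] Sob₀ s :=
  ContinuousLinearMap.ofSeqClosedGraph
    (g := { toFun := Sob.prim
            map_add' := fun f g => Sob₀.derivL_injective (by simp [Sob.derivL_prim])
            map_smul' := fun c f => Sob₀.derivL_injective (by simp [Sob.derivL_prim]) })
    fun u f g hu hg => Sob₀.derivL_injective (by
      have h1 := ((Sob₀.derivL (s := s)).continuous.tendsto _).comp hg
      have h2 := ((Sob.piL (r := s - 1)).continuous.tendsto _).comp hu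
      have h3 : Sob₀.derivL ∘ (Sob.prim ∘ u) = Sob.piL ∘ u := funext fun i => Sob.derivL_prim (u i)
      change Filter.Tendsto (Sob₀.derivL ∘ (Sob.prim ∘ u)) _ _ at h1
      rw [h3] at h1
      exact (tendsto_nhds_unique h1 h2).trans (Sob.derivL_prim f).symm)

theorem Sob.fn_primL (f : Sob (s - 1)) (x : ℝ) :
    (f.primL : Sob s).fn x = (∫ y in (0 : ℝ)..x, f.fn y) - x * Sob.mean f := rfl

@[simp] theorem Sob.derivL_primL (f : Sob (s - 1)) :
    Sob₀.derivL f.primL = f - Sob.mean f • Sob.one (s - 1) := Sob.derivL_prim f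

end operators

/-! ### The Christoffel map near the identity -/

theorem Sob.ofFun_eq {s : ℝ} {g : Sob s} {f : ℝ → ℝ} (h : ∀ x, g.fn x = f x) :
    Sob.ofFun s f = g := by
  have hex : ∃ g : Sob s, g.fn = f := ⟨g, funext h⟩
  unfold Sob.ofFun
  rw [dif_pos hex]
  exact Sob.ext_fn fun x => (congrFun hex.choose_spec x).trans (h x).symm

theorem Sob₀.ofFun_eq {s : ℝ} {g : Sob₀ s} {f : ℝ → ℝ} (h : ∀ x, (g : Sob s).fn x = f x) :
    Sob₀.ofFun s f = g := by
  have hex : ∃ g : Sob₀ s, (g : Sob s).fn = f := ⟨g, funext h⟩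
  unfold Sob₀.ofFun
  rw [dif_pos hex]
  exact Subtype.ext (Sob.ext_fn fun x => (congrFun hex.choose_spec x).trans (h x).symm)

/-- On derivatives of `C¹` functions, `invLap ∘ ∂ₓ` is minus the primitive of the zero mean part. -/
theorem invLap_deriv {f f' : ℝ → ℝ} (hf : ∀ x, HasDerivAt f (f' x) x) (hf' : Continuous f')
    (x : ℝ) :
    invLap (deriv f) x = -(∫ y in (0 : ℝ)..x, f y) + x * ∫ y in (0 : ℝ)..1, f y := by
  have hc : Continuous f := continuous_iff_continuousAt.2 fun x => (hf x).continuousAt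
  have h1 : ∀ y, ∫ z in (0 : ℝ)..y, deriv f z = f y - f 0 := fun y => by
    rw [show deriv f = f' from funext fun z => (hf z).deriv]
    exact intervalIntegral.integral_eq_sub_of_hasDerivAt (fun z _ => hf z)
      (hf'.intervalIntegrable _ _)
  have h2 : ∀ y, ∫ z in (0 : ℝ)..y, (f z - f 0) = (∫ z in (0 : ℝ)..y, f z) - y * f 0 := fun y => by
    rw [intervalIntegral.integral_sub (hc.intervalIntegrable _ _)
      (continuous_const.intervalIntegrable _ _)]
    simp
  unfold invLap
  simp only [h1, h2]
  ring

theorem Diff₀.lift_zero {s : ℝ} (φ : Diff₀ s) : φ.lift 0 = 0 := by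
  simp [Diff₀.lift, Sob₀.fn_zero]

theorem Diff₀.lift_one {s : ℝ} (φ : Diff₀ s) : φ.lift 1 = 1 := by
  have h := (φ.disp : Sob s).fn_add_one 0
  rw [Sob₀.fn_zero, zero_add] at h
  simp [Diff₀.lift, h]

section christoffel

variable {s : ℝ} [hs : Fact (5 / 2 < s)]

/-- The Jacobian `φₓ = 1 + hₓ` of `φ = id + h`. -/
def jac (h : Sob₀ s) : Sob (s - 1) := Sob.one (s - 1) + Sob₀.derivL h

/-- The inverse Jacobian `1 / φₓ`, obtained by inverting the multiplication operator of `φₓ`. It is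
meaningful only if that operator is invertible in the algebra of bounded operators, which is the case
near `φ = id`. -/
def jacInv (h : Sob₀ s) : Sob (s - 1) := Ring.inverse (Sob.mulL (jac h)) (Sob.one (s - 1))

/-- The representative `ρ - ∫ ρ φₓ dx` of a class, where `φ = id + h`. -/
def projAt (h : Sob₀ s) (ρ : SobModConst (s - 1)) : Sob (s - 1) :=
  ρ.piL - Sob.mean (ρ.piL * Sob₀.derivL h) • Sob.one (s - 1)

/-- The density `(U₁ₓ V₁ₓ / φₓ² + π(U₂) π(V₂)) φₓ`. -/
def density (h : Sob₀ s) (U V : Model s) : Sob (s - 1) :=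
  Sob₀.derivL U.1 * Sob₀.derivL V.1 * jacInv h + projAt h U.2 * projAt h V.2 * jac h

/-- The Christoffel map at `id + h` after the change of variables `y = φ(x)`, which removes the
compositions with `φ` and its inverse. -/
def localChristoffel (h : Sob₀ s) (U V : Model s) : Model s :=
  ((1 / 2 : ℝ) • (Sob.primL (density h U V) - Sob.mean (density h U V) • h),
    (Sob.consts (s - 1)).mkQL (-(1 / 2 : ℝ) • (Sob₀.derivL U.1 * jacInv h * projAt h V.2
      + Sob₀.derivL V.1 * jacInv h * projAt h U.2)))

theorem fn_jacInv {h : Sob₀ s} (hu : IsUnit (Sob.mulL (jac h))) (x : ℝ) :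
    (jacInv h).fn x = ((jac h).fn x)⁻¹ := by
  have h1 : jac h * jacInv h = Sob.one (s - 1) :=
    congrArg (fun T : Sob (s - 1) →L[ℝ] Sob (s - 1) => T (Sob.one (s - 1)))
      (Ring.mul_inverse_cancel _ hu)
  have h2 : (jac h).fn x * (jacInv h).fn x = 1 := by rw [← Sob.fn_mul, h1, Sob.fn_one]
  exact eq_inv_of_mul_eq_one_right h2

theorem fn_jac (h : Sob₀ s) (x : ℝ) : (jac h).fn x = 1 + deriv (h : Sob s).fn x := by
  simp [jac]

theorem Diff₀.hasDerivAt_lift (φ : Diff₀ s) (x : ℝ) :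
    HasDerivAt φ.lift ((jac φ.disp).fn x) x := by
  rw [fn_jac]
  exact (hasDerivAt_id x).add ((φ.disp : Sob s).hasDerivAt_fn x)

theorem Diff₀.jac_pos (φ : Diff₀ s) (x : ℝ) : 0 < (jac φ.disp).fn x := by
  rw [fn_jac]
  have := φ.mem x
  linarith

theorem Diff₀.strictMono_lift (φ : Diff₀ s) : StrictMono φ.lift :=
  strictMono_of_deriv_pos fun x => by
    rw [(φ.hasDerivAt_lift x).deriv]
    exact φ.jac_pos x

theorem Diff₀.continuous_lift (φ : Diff₀ s) : Continuous φ.lift :=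
  continuous_iff_continuousAt.2 fun x => (φ.hasDerivAt_lift x).continuousAt

theorem Diff₀.surjective_lift (φ : Diff₀ s) : Function.Surjective φ.lift := by
  have hb : ∀ x, |(φ.disp : Sob s).fn x| ≤ ‖(φ.disp : Sob s).toCont‖ := fun x =>
    (φ.disp : Sob s).toCont.norm_coe_le_norm _
  refine φ.continuous_lift.surjective ?_ ?_
  · have h : Filter.Tendsto (fun x => x + -‖(φ.disp : Sob s).toCont‖) Filter.atTop Filter.atTop :=
      Filter.tendsto_atTop_add_const_right _ _ Filter.tendsto_id
    exact Filter.tendsto_atTop_mono (fun x => add_le_add_right (abs_le.1 (hb x)).1 x) h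
  · have h : Filter.Tendsto (fun x => x + ‖(φ.disp : Sob s).toCont‖) Filter.atBot Filter.atBot :=
      Filter.tendsto_atBot_add_const_right _ _ Filter.tendsto_id
    exact Filter.tendsto_atBot_mono (fun x => add_le_add_right (abs_le.1 (hb x)).2 x) h

/-- The lift of the inverse diffeomorphism. -/
def Diff₀.liftInv (φ : Diff₀ s) : ℝ → ℝ := Function.invFun φ.lift

theorem Diff₀.liftInv_lift (φ : Diff₀ s) (x : ℝ) : φ.liftInv (φ.lift x) = x :=
  Function.leftInverse_invFun φ.strictMono_lift.injective x

theorem Diff₀.lift_liftInv (φ : Diff₀ s) (x : ℝ) : φ.lift (φ.liftInv x) = x :=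
  Function.rightInverse_invFun φ.surjective_lift x

theorem Diff₀.continuous_liftInv (φ : Diff₀ s) : Continuous φ.liftInv := by
  let e := φ.strictMono_lift.orderIsoOfSurjective _ φ.surjective_lift
  have he : φ.liftInv = e.symm := funext fun x => by
    rw [← φ.lift_liftInv x, φ.liftInv_lift]
    exact (e.symm_apply_apply _).symm
  rw [he]
  exact e.symm.continuous

theorem Diff₀.hasDerivAt_liftInv (φ : Diff₀ s) (y : ℝ) :
    HasDerivAt φ.liftInv ((jac φ.disp).fn (φ.liftInv y))⁻¹ y :=
  HasDerivAt.of_local_left_inverse φ.continuous_liftInv.continuousAt (φ.hasDerivAt_lift _)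
    (φ.jac_pos _).ne' (Filter.Eventually.of_forall φ.lift_liftInv)

theorem Diff₀.deriv_comp_liftInv (φ : Diff₀ s) (hu : IsUnit (Sob.mulL (jac φ.disp)))
    {f : ℝ → ℝ} {f' : ℝ} {y : ℝ} (hf : HasDerivAt f f' (φ.liftInv y)) :
    deriv (f ∘ φ.liftInv) y = f' * (jacInv φ.disp).fn (φ.liftInv y) := by
  rw [fn_jacInv hu]
  exact (hf.comp y (φ.hasDerivAt_liftInv y)).deriv

theorem Diff₀.integral_comp_liftInv (φ : Diff₀ s) (f : Sob (s - 1)) (t : ℝ) :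
    ∫ y in (0 : ℝ)..φ.lift t, f.fn (φ.liftInv y)
      = ∫ x in (0 : ℝ)..t, (f * jac φ.disp).fn x := by
  have h := intervalIntegral.integral_comp_mul_deriv (a := 0) (b := t) (g := f.fn ∘ φ.liftInv)
    (fun x _ => φ.hasDerivAt_lift x) (jac φ.disp).continuous_fn.continuousOn
    (f.continuous_fn.comp φ.continuous_liftInv)
  rw [φ.lift_zero] at h
  simpa [φ.liftInv_lift] using h.symm

theorem Diff₀.integral_comp_liftInv_one (φ : Diff₀ s) (f : Sob (s - 1)) :
    ∫ y in (0 : ℝ)..1, f.fn (φ.liftInv y) = Sob.mean (f * jac φ.disp) := by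
  have h := φ.integral_comp_liftInv f 1
  rw [φ.lift_one] at h
  exact h

theorem Sob.mul_one_right (f : Sob (s - 1)) : f * Sob.one (s - 1) = f :=
  Sob.ext_fn fun x => by simp

theorem mean_mul_jac (h : Sob₀ s) (f : Sob (s - 1)) :
    Sob.mean (f * jac h) = Sob.mean f + Sob.mean (f * Sob₀.derivL h) := by
  rw [← map_add]
  congr 1
  exact Sob.ext_fn fun x => by simp [jac]; ring

/-- The zero mean part of `ρ ∘ φ⁻¹`, pulled back by `φ`; the mean of `ρ ∘ φ⁻¹` is `∫ ρ φₓ dx`. -/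
theorem Diff₀.subMean_comp_liftInv (φ : Diff₀ s) (ρ : SobModConst (s - 1)) (y : ℝ) :
    subMean (ρ.rep ∘ φ.liftInv) y = (projAt φ.disp ρ).fn (φ.liftInv y) := by
  obtain ⟨f, hf, hfe⟩ := ρ.exists_fn_eq_rep
  have h1 := φ.integral_comp_liftInv_one f
  have h2 : f * Sob₀.derivL φ.disp = ρ.piL * Sob₀.derivL φ.disp
      + Sob.mean f • Sob₀.derivL φ.disp := by
    nth_rw 1 [hfe]
    exact Sob.ext_fn fun x => by simp; ring
  have h3 : f.fn (φ.liftInv y) = ρ.piL.fn (φ.liftInv y) + Sob.mean f := by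
    nth_rw 1 [hfe]
    simp
  rw [mean_mul_jac, h2] at h1
  unfold subMean
  simp only [Function.comp_apply, ← hf, h1, h3, projAt]
  simp
  ring

/-- The change of variables `y = φ(x)` in the Christoffel map. In particular both components of the
defining expression are of the required Sobolev class, so that no default value of `ofFun` occurs. -/
theorem KS.christoffel_eq (p : KS s) (hu : IsUnit (Sob.mulL (jac p.diffeo.disp))) (U V : Model s) :
    p.christoffel U V = localChristoffel p.diffeo.disp U V := by
  set φ := p.diffeo with hφ
  have hψ : Function.invFun φ.lift = φ.liftInv := rfl
  have hphi : p.phi = φ.lift := rfl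
  have hd : ∀ (f : Sob₀ s) (y : ℝ), deriv ((f : Sob s).fn ∘ φ.liftInv) y
      = (Sob₀.derivL f * jacInv φ.disp).fn (φ.liftInv y) := fun f y =>
    φ.deriv_comp_liftInv hu ((f : Sob s).hasDerivAt_fn _)
  have hm := φ.subMean_comp_liftInv
  unfold KS.christoffel
  simp only [hphi, hψ]
  refine Prod.ext ?_ ?_
  · refine Sob₀.ofFun_eq fun t => ?_
    set Φ : Sob (s - 1) := Sob₀.derivL U.1 * jacInv φ.disp * (Sob₀.derivL V.1 * jacInv φ.disp)
      + projAt φ.disp U.2 * projAt φ.disp V.2 with hΦ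
    have hf : (fun y =>
        deriv ((U.1 : Sob s).fn ∘ φ.liftInv) y * deriv ((V.1 : Sob s).fn ∘ φ.liftInv) y
        + subMean (U.2.rep ∘ φ.liftInv) y * subMean (V.2.rep ∘ φ.liftInv) y)
        = Φ.fn ∘ φ.liftInv := funext fun y => by
      simp [hd, hm, hΦ]
    -- `Φ ∘ φ⁻¹` is the integrand before the substitution, which multiplies `Φ` by `φₓ`
    have hj : Φ * jac φ.disp = density φ.disp U V := Sob.ext_fn fun x => by
      have := (φ.jac_pos x).ne'
      simp only [hΦ, density, Sob.fn_mul, Sob.fn_add, fn_jacInv hu]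
      field_simp
    simp only [Function.comp_apply, christoffelOne]
    rw [hf, invLap_deriv
      (f' := fun y => deriv Φ.fn (φ.liftInv y) * ((jac φ.disp).fn (φ.liftInv y))⁻¹)
      (fun y => (Φ.hasDerivAt_fn _).comp y (φ.hasDerivAt_liftInv y))]
    · simp only [Function.comp_apply]
      rw [φ.integral_comp_liftInv, φ.integral_comp_liftInv_one, hj]
      simp only [localChristoffel, Diff₀.lift]
      simp [Sob.fn_primL]
      ring
    · exact ((Sob.continuous_deriv Fact.out Φ).comp φ.continuous_liftInv).mul
        (((jac φ.disp).continuous_fn.comp φ.continuous_liftInv).inv₀ fun y => (φ.jac_pos _).ne')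
  · refine congrArg Submodule.Quotient.mk (Sob.ofFun_eq fun t => ?_)
    simp [christoffelTwo, hd, hm, φ.liftInv_lift]
    ring

end christoffel

/-! ### The derivative of the Christoffel map at the identity -/

section mul

variable {r : ℝ} [hr : Fact (3 / 2 < r)]

theorem differentiableAt_sobMul {E : Type*} [NormedAddCommGroup E] [NormedSpace ℝ E]
    {f g : E → Sob r} {x : E} (hf : DifferentiableAt ℝ f x) (hg : DifferentiableAt ℝ g x) :
    DifferentiableAt ℝ (fun y => f y * g y) x :=
  ((Sob.mulL (r := r)).differentiableAt.comp x hf).clm_apply hg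

theorem hasDerivAt_sobMul {f g : ℝ → Sob r} {f' g' : Sob r} {x : ℝ} (hf : HasDerivAt f f' x)
    (hg : HasDerivAt g g' x) : HasDerivAt (fun y => f y * g y) (f x * g' + f' * g x) x :=
  (Sob.mulL (r := r)).hasDerivAt_of_bilinear (fun _ => hf) (fun _ => hg)

theorem Sob.mulL_one : Sob.mulL (Sob.one r) = 1 := by
  ext f : 1
  exact Sob.ext_fn fun x => by simp [Sob.mulL_apply]

end mul

theorem hasDerivAt_ringInverse_of_eq_one {A : Type*} [NormedRing A] [NormedAlgebra ℝ A]
    [CompleteSpace A] {T : ℝ → A} {T' : A} {x : ℝ} (hT : HasDerivAt T T' x) (h1 : T x = 1) :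
    HasDerivAt (fun t => Ring.inverse (T t)) (-T') x := by
  have h2 := hasFDerivAt_ringInverse (𝕜 := ℝ) (1 : Aˣ)
  rw [Units.val_one, ← h1] at h2
  refine (h2.comp_hasDerivAt x hT).congr_deriv ?_
  simp

section christoffelDeriv

variable {s : ℝ} [hs : Fact (5 / 2 < s)]

@[simp] theorem jac_zero : jac (0 : Sob₀ s) = Sob.one (s - 1) := by simp [jac]

theorem isUnit_mulL_jac_zero : IsUnit (Sob.mulL (jac (0 : Sob₀ s))) := by
  rw [jac_zero, Sob.mulL_one]
  exact isUnit_one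

@[simp] theorem jacInv_zero : jacInv (0 : Sob₀ s) = Sob.one (s - 1) := by
  simp [jacInv, Sob.mulL_one]

@[simp] theorem projAt_zero (ρ : SobModConst (s - 1)) : projAt (0 : Sob₀ s) ρ = ρ.piL := by
  have : ρ.piL * (0 : Sob (s - 1)) = 0 := Sob.ext_fn fun x => by simp
  simp [projAt, this]

theorem differentiable_jac : Differentiable ℝ (jac (s := s)) :=
  (Sob₀.derivL (s := s)).differentiable.const_add _

theorem differentiableAt_jacInv : DifferentiableAt ℝ (jacInv (s := s)) 0 :=
  (((Sob.mulL (r := s - 1)).differentiableAt.comp (0 : Sob₀ s)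
    (differentiable_jac 0)).inverse isUnit_mulL_jac_zero).clm_apply (differentiableAt_const _)

theorem differentiableAt_projAt {E : Type*} [NormedAddCommGroup E] [NormedSpace ℝ E]
    {h : E → Sob₀ s} {ρ : E → SobModConst (s - 1)} {x : E} (hh : DifferentiableAt ℝ h x)
    (hρ : DifferentiableAt ℝ ρ x) : DifferentiableAt ℝ (fun y => projAt (h y) (ρ y)) x := by
  have h1 : DifferentiableAt ℝ (fun y => (ρ y).piL) x :=
    (SobModConst.piL (r := s - 1)).differentiableAt.comp x hρ
  have h2 : DifferentiableAt ℝ (fun y => Sob₀.derivL (h y)) x :=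
    (Sob₀.derivL (s := s)).differentiableAt.comp x hh
  exact h1.sub (((Sob.mean (r := s - 1)).differentiableAt.comp x
    (differentiableAt_sobMul h1 h2)).smul_const _)

theorem differentiableAt_localChristoffel (U V : Model s) :
    DifferentiableAt ℝ (fun z : Sob₀ s × Model s × Model s => localChristoffel z.1 z.2.1 z.2.2)
      (0, U, V) := by
  have h1 : DifferentiableAt ℝ (fun z : Sob₀ s × Model s × Model s => z.1) (0, U, V) :=
    differentiableAt_fst
  have h2 : DifferentiableAt ℝ (fun z : Sob₀ s × Model s × Model s => z.2.1) (0, U, V) :=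
    differentiableAt_snd.fst
  have h3 : DifferentiableAt ℝ (fun z : Sob₀ s × Model s × Model s => z.2.2) (0, U, V) :=
    differentiableAt_snd.snd
  have hU : DifferentiableAt ℝ (fun z : Sob₀ s × Model s × Model s => Sob₀.derivL z.2.1.1)
      (0, U, V) := (Sob₀.derivL (s := s)).differentiableAt.comp _ h2.fst
  have hV : DifferentiableAt ℝ (fun z : Sob₀ s × Model s × Model s => Sob₀.derivL z.2.2.1)
      (0, U, V) := (Sob₀.derivL (s := s)).differentiableAt.comp _ h3.fst
  have hq : DifferentiableAt ℝ (fun z : Sob₀ s × Model s × Model s => jacInv z.1) (0, U, V) :=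
    DifferentiableAt.comp (g := jacInv) _ differentiableAt_jacInv h1
  have hj : DifferentiableAt ℝ (fun z : Sob₀ s × Model s × Model s => jac z.1) (0, U, V) :=
    (differentiable_jac _).comp _ h1
  have hpU := differentiableAt_projAt h1 h2.snd
  have hpV := differentiableAt_projAt h1 h3.snd
  have hF : DifferentiableAt ℝ
      (fun z : Sob₀ s × Model s × Model s => density z.1 z.2.1 z.2.2) (0, U, V) :=
    (differentiableAt_sobMul (differentiableAt_sobMul hU hV) hq).add
      (differentiableAt_sobMul (differentiableAt_sobMul hpU hpV) hj)
  refine DifferentiableAt.prodMk ?_ ?_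
  · exact (((Sob.primL (s := s)).differentiableAt.comp _ hF).sub
      (((Sob.mean (r := s - 1)).differentiableAt.comp _ hF).smul h1)).const_smul (1 / 2 : ℝ)
  · exact ((Sob.consts (s - 1)).mkQL).differentiableAt.comp _
      (((differentiableAt_sobMul (differentiableAt_sobMul hU hq) hpV).add
        (differentiableAt_sobMul (differentiableAt_sobMul hV hq) hpU)).const_smul (-(1 / 2 : ℝ)))

/-- The Christoffel map at the identity. -/
def christoffelId (U V : Model s) : Model s :=
  ((1 / 2 : ℝ) • Sob.primL (Sob₀.derivL U.1 * Sob₀.derivL V.1 + U.2.piL * V.2.piL),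
    (Sob.consts (s - 1)).mkQL (-(1 / 2 : ℝ) • (Sob₀.derivL U.1 * V.2.piL
      + Sob₀.derivL V.1 * U.2.piL)))

/-- The derivative of the Christoffel map at the identity in the direction of a vector with first
component `k`. -/
def christoffelDeriv (k : Sob₀ s) (U V : Model s) : Model s :=
  ((1 / 2 : ℝ) • (Sob.primL ((U.2.piL * V.2.piL - Sob₀.derivL U.1 * Sob₀.derivL V.1) * Sob₀.derivL k
        - Sob.mean (U.2.piL * Sob₀.derivL k) • V.2.piL
        - Sob.mean (V.2.piL * Sob₀.derivL k) • U.2.piL)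
      - Sob.mean (Sob₀.derivL U.1 * Sob₀.derivL V.1 + U.2.piL * V.2.piL) • k),
    (Sob.consts (s - 1)).mkQL ((1 / 2 : ℝ) • (
      (Sob₀.derivL U.1 * V.2.piL + Sob₀.derivL V.1 * U.2.piL) * Sob₀.derivL k
        + Sob.mean (V.2.piL * Sob₀.derivL k) • Sob₀.derivL U.1
        + Sob.mean (U.2.piL * Sob₀.derivL k) • Sob₀.derivL V.1)))

theorem density_zero (U V : Model s) :
    density 0 U V = Sob₀.derivL U.1 * Sob₀.derivL V.1 + U.2.piL * V.2.piL := by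
  simp only [density, jacInv_zero, projAt_zero, jac_zero, Sob.mul_one_right]

theorem localChristoffel_zero (U V : Model s) : localChristoffel 0 U V = christoffelId U V := by
  simp only [localChristoffel, christoffelId, density_zero, jacInv_zero, projAt_zero,
    Sob.mul_one_right, smul_zero, sub_zero]

theorem christoffelId_comm (U V : Model s) : christoffelId U V = christoffelId V U := by
  refine Prod.ext ?_ ?_
  · refine congrArg (fun f => (1 / 2 : ℝ) • Sob.primL f) (Sob.ext_fn fun x => ?_)
    simp
    ring
  · refine congrArg (Sob.consts (s - 1)).mkQL (Sob.ext_fn fun x => ?_)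
    simp
    ring

theorem christoffelId_add_smul_left (U A V : Model s) (t : ℝ) :
    christoffelId (U + t • A) V = christoffelId U V + t • christoffelId A V := by
  refine Prod.ext ?_ ?_
  · simp only [christoffelId, Prod.fst_add, Prod.smul_fst, ← map_smul, ← map_add]
    refine congrArg Sob.primL (Sob.ext_fn fun x => ?_)
    simp [-Sob₀.fn_derivL]
    ring
  · simp only [christoffelId, Prod.snd_add, Prod.smul_snd, ← map_smul, ← map_add]
    refine congrArg (Sob.consts (s - 1)).mkQL (Sob.ext_fn fun x => ?_)
    simp [-Sob₀.fn_derivL]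
    ring

theorem hasDerivAt_jacInv (k : Sob₀ s) :
    HasDerivAt (fun t : ℝ => jacInv (t • k)) (-Sob₀.derivL k) 0 := by
  have h1 : HasDerivAt (fun t : ℝ => Sob.mulL (jac (t • k))) (Sob.mulL (Sob₀.derivL k)) 0 := by
    have h : HasDerivAt (fun t : ℝ => jac (t • k)) (Sob₀.derivL k) 0 := by
      have := ((hasDerivAt_id (0 : ℝ)).smul_const (Sob₀.derivL k)).const_add (Sob.one (s - 1))
      simpa [jac] using this
    exact (Sob.mulL (r := s - 1)).hasFDerivAt.comp_hasDerivAt _ h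
  have h2 := (hasDerivAt_ringInverse_of_eq_one h1
    (by rw [zero_smul, jac_zero, Sob.mulL_one])).clm_apply
      (hasDerivAt_const (0 : ℝ) (Sob.one (s - 1)))
  refine h2.congr_deriv ?_
  rw [map_zero, add_zero, neg_apply, Sob.mulL_apply, Sob.mul_one_right]

theorem hasDerivAt_projAt (k : Sob₀ s) (ρ : SobModConst (s - 1)) :
    HasDerivAt (fun t : ℝ => projAt (t • k) ρ)
      (-(Sob.mean (ρ.piL * Sob₀.derivL k) • Sob.one (s - 1))) 0 := by
  have h1 : (fun t : ℝ => projAt (t • k) ρ) = fun t : ℝ =>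
      ρ.piL - t • (Sob.mean (ρ.piL * Sob₀.derivL k) • Sob.one (s - 1)) := funext fun t => by
    have h2 : ρ.piL * (t • Sob₀.derivL k) = t • (ρ.piL * Sob₀.derivL k) :=
      Sob.ext_fn fun x => by simp; ring
    simp only [projAt, map_smul, h2, smul_smul, smul_eq_mul]
  rw [h1]
  simpa using ((hasDerivAt_id (0 : ℝ)).smul_const
    (Sob.mean (ρ.piL * Sob₀.derivL k) • Sob.one (s - 1))).const_sub ρ.piL

/-- The derivative along the line `t ↦ id + t k`, with the arguments `U` and `V` held fixed. -/
theorem hasDerivAt_localChristoffel (k : Sob₀ s) (U V : Model s) :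
    HasDerivAt (fun t : ℝ => localChristoffel (t • k) U V) (christoffelDeriv k U V) 0 := by
  have hk : HasDerivAt (fun t : ℝ => t • k) k 0 := by
    simpa using (hasDerivAt_id (0 : ℝ)).smul_const k
  have hj : HasDerivAt (fun t : ℝ => jac (t • k)) (Sob₀.derivL k) 0 := by
    have := ((hasDerivAt_id (0 : ℝ)).smul_const (Sob₀.derivL k)).const_add (Sob.one (s - 1))
    simpa [jac] using this
  have hq := hasDerivAt_jacInv k
  have hU := hasDerivAt_projAt k U.2
  have hV := hasDerivAt_projAt k V.2
  have hF : HasDerivAt (fun t : ℝ => density (t • k) U V)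
      ((U.2.piL * V.2.piL - Sob₀.derivL U.1 * Sob₀.derivL V.1) * Sob₀.derivL k
        - Sob.mean (U.2.piL * Sob₀.derivL k) • V.2.piL
        - Sob.mean (V.2.piL * Sob₀.derivL k) • U.2.piL) 0 := by
    refine ((hasDerivAt_sobMul (hasDerivAt_const (0 : ℝ)
      (Sob₀.derivL U.1 * Sob₀.derivL V.1)) hq).add
      (hasDerivAt_sobMul (hasDerivAt_sobMul hU hV) hj)).congr_deriv ?_
    simp only [zero_smul, jacInv_zero, projAt_zero, jac_zero]
    exact Sob.ext_fn fun x => by simp [-Sob₀.fn_derivL]; ring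
  refine HasDerivAt.prodMk ?_ ?_
  · refine ((((Sob.primL (s := s)).hasFDerivAt.comp_hasDerivAt _ hF).sub
      (((Sob.mean (r := s - 1)).hasFDerivAt.comp_hasDerivAt _ hF).smul hk)).const_smul
        (1 / 2 : ℝ)).congr_deriv ?_
    simp only [Function.comp_apply, zero_smul, density_zero, smul_zero, add_zero]
  · refine ((Sob.consts (s - 1)).mkQL.hasFDerivAt.comp_hasDerivAt (0 : ℝ)
      (((hasDerivAt_sobMul (hasDerivAt_sobMul
        (hasDerivAt_const (0 : ℝ) (Sob₀.derivL U.1)) hq) hV).add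
        (hasDerivAt_sobMul (hasDerivAt_sobMul (hasDerivAt_const (0 : ℝ) (Sob₀.derivL V.1)) hq)
          hU)).const_smul (-(1 / 2 : ℝ)))).congr_deriv ?_
    refine congrArg (Sob.consts (s - 1)).mkQL ?_
    simp only [zero_smul, jacInv_zero, projAt_zero]
    exact Sob.ext_fn fun x => by simp [-Sob₀.fn_derivL]; ring

/-- The product rule for the Christoffel map applied to two vector fields. -/
theorem fderiv_localChristoffel {Y Z : Model s → Model s} {x : Model s} (hx : x.1 = 0)
    (hY : DifferentiableAt ℝ Y x) (hZ : DifferentiableAt ℝ Z x) :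
    DifferentiableAt ℝ (fun y => localChristoffel y.1 (Z y) (Y y)) x ∧ ∀ w : Model s,
    fderiv ℝ (fun y => localChristoffel y.1 (Z y) (Y y)) x w
      = christoffelDeriv w.1 (Z x) (Y x) + christoffelId (fderiv ℝ Z x w) (Y x)
        + christoffelId (Z x) (fderiv ℝ Y x w) := by
  have hG := differentiableAt_localChristoffel (Z x) (Y x)
  rw [← hx] at hG
  set G : Sob₀ s × Model s × Model s → Model s :=
    fun z => localChristoffel z.1 z.2.1 z.2.2 with hGdef
  have hin : HasFDerivAt (fun y => (y.1, Z y, Y y))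
      ((ContinuousLinearMap.fst ℝ _ _).prod ((fderiv ℝ Z x).prod (fderiv ℝ Y x))) x :=
    hasFDerivAt_fst.prodMk (hZ.hasFDerivAt.prodMk hY.hasFDerivAt)
  have hcomp := HasFDerivAt.comp (g := G) x hG.hasFDerivAt hin
  refine ⟨hcomp.differentiableAt, fun w => ?_⟩
  have hcomp' := hcomp.fderiv
  change fderiv ℝ (fun y => localChristoffel y.1 (Z y) (Y y)) x = _ at hcomp'
  have hline : ∀ z : Sob₀ s × Model s × Model s,
      HasDerivAt (fun t : ℝ => G ((x.1, Z x, Y x) + t • z)) (fderiv ℝ G (x.1, Z x, Y x) z) 0 := by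
    intro z
    have h := (hasDerivAt_id (0 : ℝ)).smul_const z |>.const_add
      ((x.1, Z x, Y x) : Sob₀ s × Model s × Model s)
    simp only [one_smul] at h
    refine HasFDerivAt.comp_hasDerivAt (l := G) (0 : ℝ) ?_ h
    simpa using hG.hasFDerivAt
  -- since `G` is differentiable, its partial derivatives can be read off along lines
  have hlin : ∀ a b : Model s, HasDerivAt (fun t : ℝ => a + t • b) b 0 := fun a b => by
    simpa using ((hasDerivAt_id (0 : ℝ)).smul_const b).const_add a
  have h1 : fderiv ℝ G (x.1, Z x, Y x) (w.1, 0, 0) = christoffelDeriv w.1 (Z x) (Y x) := by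
    refine (hline _).unique ?_
    convert! hasDerivAt_localChristoffel w.1 (Z x) (Y x) using 1
    ext1 t
    simp [hGdef, hx]
  have h2 : ∀ A, fderiv ℝ G (x.1, Z x, Y x) (0, A, 0) = christoffelId A (Y x) := fun A => by
    refine (hline _).unique ?_
    convert! hlin (christoffelId (Z x) (Y x)) (christoffelId A (Y x)) using 1
    ext1 t
    simp [hGdef, hx, localChristoffel_zero, christoffelId_add_smul_left]
  have h3 : ∀ B, fderiv ℝ G (x.1, Z x, Y x) (0, 0, B) = christoffelId (Z x) B := fun B => by
    refine (hline _).unique ?_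
    convert! hlin (christoffelId (Z x) (Y x)) (christoffelId (Z x) B) using 1
    ext1 t
    simp only [hGdef, hx, christoffelId_comm (Z x), ← christoffelId_add_smul_left]
    simp [localChristoffel_zero, christoffelId_comm (Z x)]
  rw [hcomp', ← h1, ← h2, ← h3, ← map_add, ← map_add]
  simp

end christoffelDeriv

/-! ### The curvature tensor at the identity -/

namespace KS

variable {s : ℝ} [hs : Fact (5 / 2 < s)]

/-- Directional derivatives are computed in the chart around the point. -/
theorem dirDeriv_eq_fderiv (Y : KS s → Model s) (p : KS s) (U : Model s) :
    dirDeriv Y p U = fderiv ℝ (Y ∘ ofCoord p.winding) p.coord U := by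
  have hw : writtenInExtChartAt 𝓘(ℝ, Model s) 𝓘(ℝ, Model s) p Y = Y ∘ ofCoord p.winding := rfl
  have hc : extChartAt 𝓘(ℝ, Model s) p p = p.coord := rfl
  unfold dirDeriv
  by_cases h : MDifferentiableAt 𝓘(ℝ, Model s) 𝓘(ℝ, Model s) Y p
  · rw [h.mfderiv, hw, hc]
    simp only [mfld_simps, fderivWithin_univ]
    rfl
  · -- then the local representative is not differentiable either, and both derivatives are `0`
    rw [mfderiv_zero_of_not_mdifferentiableAt h]
    have hd : ¬DifferentiableAt ℝ (Y ∘ ofCoord p.winding) p.coord := fun hd => h (by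
      rw [mdifferentiableAt_iff, hw, hc]
      refine ⟨?_, hd.differentiableWithinAt⟩
      have hcont := ((chart p.winding).continuousAt (x := p) rfl)
      have h1 : ContinuousAt ((Y ∘ ofCoord p.winding) ∘ coord) p :=
        ContinuousAt.comp (g := Y ∘ ofCoord p.winding) hd.continuousAt hcont
      refine h1.congr ?_
      filter_upwards [(chart p.winding).open_source.mem_nhds (x := p) rfl] with q hq
      exact congrArg Y ((chart p.winding).left_inv hq))
    rw [fderiv_zero_of_not_differentiableAt hd]
    rfl

theorem contDiffAt_comp_ofCoord {Y : KS s → Model s}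
    (hY : ContMDiff 𝓘(ℝ, Model s) 𝓘(ℝ, Model s) ∞ Y) (p : KS s) :
    ContDiffAt ℝ ∞ (Y ∘ ofCoord p.winding) p.coord := by
  have h := (contMDiffAt_iff.1 (hY p)).2
  have hw : extChartAt 𝓘(ℝ, Model s) (Y p) ∘ Y ∘ (extChartAt 𝓘(ℝ, Model s) p).symm
      = Y ∘ ofCoord p.winding := rfl
  have hc : extChartAt 𝓘(ℝ, Model s) p p = p.coord := rfl
  rw [hw, hc] at h
  simp only [mfld_simps] at h
  exact contDiffWithinAt_univ.1 h

/-- Near the identity, in the chart, the Christoffel map is given by `localChristoffel`. -/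
theorem eventually_christoffel (n : ℤ) {x₀ : Model s} (hx₀ : x₀.1 = 0) :
    ∀ᶠ x in 𝓝 x₀, x.1 ∈ diffSet s ∧
      ∀ U V, (ofCoord n x).christoffel U V = localChristoffel x.1 U V := by
  have h0 : (0 : Sob₀ s) ∈ diffSet s := (Diff₀.id s).mem
  have hfst : Filter.Tendsto (fun x : Model s => x.1) (𝓝 x₀) (𝓝 0) := by
    rw [← hx₀]
    exact continuous_fst.continuousAt
  have h1 : ∀ᶠ h in 𝓝 (0 : Sob₀ s), h ∈ diffSet s := (isOpen_diffSet Fact.out).mem_nhds h0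
  have h2 : ∀ᶠ h in 𝓝 (0 : Sob₀ s), IsUnit (Sob.mulL (jac h)) :=
    ((Sob.mulL (r := s - 1)).continuous.comp differentiable_jac.continuous).continuousAt.eventually
      (Units.isOpen.mem_nhds isUnit_mulL_jac_zero)
  filter_upwards [hfst.eventually h1, hfst.eventually h2] with x hx hu
  refine ⟨hx, fun U V => ?_⟩
  have hd : (ofCoord n x).diffeo.disp = x.1 := congrArg Prod.fst (coord_ofCoord n hx)
  rw [christoffel_eq _ (by rwa [hd]), hd]

theorem christoffel_e (U V : Model s) : (e s).christoffel U V = christoffelId U V := by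
  have hd : (e s).diffeo.disp = 0 := rfl
  rw [christoffel_eq _ (by rw [hd]; exact isUnit_mulL_jac_zero), hd, localChristoffel_zero]

/-- The curvature tensor at the identity in terms of the Christoffel map and its derivative. -/
def curvatureId (u v w : Model s) : Model s :=
  christoffelDeriv v.1 w u - christoffelDeriv u.1 w v
    + christoffelId (christoffelId w v) u - christoffelId (christoffelId w u) v

theorem dirDeriv_nabla {Y Z : KS s → Model s}
    (hY : ContMDiff 𝓘(ℝ, Model s) 𝓘(ℝ, Model s) ∞ Y)
    (hZ : ContMDiff 𝓘(ℝ, Model s) 𝓘(ℝ, Model s) ∞ Z) (w : Model s) :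
    dirDeriv (nabla Y Z) (e s) w =
      fderiv ℝ (fderiv ℝ (Z ∘ ofCoord (e s).winding)) (e s).coord w (Y (e s))
        + dirDeriv Z (e s) (dirDeriv Y (e s) w)
        - (christoffelDeriv w.1 (Z (e s)) (Y (e s)) + christoffelId (dirDeriv Z (e s) w) (Y (e s))
          + christoffelId (Z (e s)) (dirDeriv Y (e s) w)) := by
  have hY' := contDiffAt_comp_ofCoord hY (e s)
  have hZ' := contDiffAt_comp_ofCoord hZ (e s)
  have hoe : ofCoord (e s).winding (e s).coord = e s := ofCoord_coord (e s)
  set n := (e s).winding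
  set x₀ := (e s).coord with hx₀
  have hx0 : x₀.1 = 0 := rfl
  have hYd : DifferentiableAt ℝ (Y ∘ ofCoord n) x₀ := hY'.differentiableAt (by simp)
  have hZd : DifferentiableAt ℝ (Z ∘ ofCoord n) x₀ := hZ'.differentiableAt (by simp)
  have hZdd : DifferentiableAt ℝ (fderiv ℝ (Z ∘ ofCoord n)) x₀ :=
    (hZ'.fderiv_right (m := 1) (by norm_cast)).differentiableAt (by simp)
  have hev : nabla Y Z ∘ ofCoord n =ᶠ[𝓝 x₀] fun x =>
      fderiv ℝ (Z ∘ ofCoord n) x ((Y ∘ ofCoord n) x)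
        - localChristoffel x.1 ((Z ∘ ofCoord n) x) ((Y ∘ ofCoord n) x) := by
    filter_upwards [eventually_christoffel n hx0] with x hx
    simp only [Function.comp_apply, nabla, hx.2, dirDeriv_eq_fderiv, winding_ofCoord,
      coord_ofCoord n hx.1]
  obtain ⟨hGd, hG⟩ := fderiv_localChristoffel hx0 hYd hZd
  have hY0 : (Y ∘ ofCoord n) x₀ = Y (e s) := congrArg Y hoe
  have hZ0 : (Z ∘ ofCoord n) x₀ = Z (e s) := congrArg Z hoe
  have hd : ∀ W v, dirDeriv W (e s) v = fderiv ℝ (W ∘ ofCoord n) x₀ v := fun W v =>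
    dirDeriv_eq_fderiv W (e s) v
  rw [hd, hd, hd, hd, hev.fderiv_eq, fderiv_fun_sub (hZdd.clm_apply hYd) hGd, sub_apply, hG,
    fderiv_clm_apply hZdd hYd, hY0, hZ0]
  simp only [add_apply, ContinuousLinearMap.comp_apply, ContinuousLinearMap.flip_apply]
  abel

/-- The curvature operator is tensorial at `e`. -/
theorem curvatureField_e {X Y Z : KS s → Model s}
    (hX : ContMDiff 𝓘(ℝ, Model s) 𝓘(ℝ, Model s) ∞ X)
    (hY : ContMDiff 𝓘(ℝ, Model s) 𝓘(ℝ, Model s) ∞ Y)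
    (hZ : ContMDiff 𝓘(ℝ, Model s) 𝓘(ℝ, Model s) ∞ Z) :
    curvatureField X Y Z (e s) = curvatureId (X (e s)) (Y (e s)) (Z (e s)) := by
  have hsymm : fderiv ℝ (fderiv ℝ (Z ∘ ofCoord (e s).winding)) (e s).coord (X (e s)) (Y (e s))
      = fderiv ℝ (fderiv ℝ (Z ∘ ofCoord (e s).winding)) (e s).coord (Y (e s)) (X (e s)) :=
    ((contDiffAt_comp_ofCoord hZ (e s)).isSymmSndFDerivAt (by
      rw [minSmoothness_of_isRCLikeNormedField]
      exact WithTop.coe_le_coe.2 (le_top (a := (2 : ℕ∞))))) _ _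
  have hl : ∀ A B C : Model s, christoffelId (A - B) C = christoffelId A C - christoffelId B C :=
    fun A B C => by
      have := christoffelId_add_smul_left A B C (-1)
      simpa [sub_eq_add_neg] using this
  have hr : ∀ A B C : Model s, christoffelId A (B - C) = christoffelId A B - christoffelId A C :=
    fun A B C => by simp only [christoffelId_comm A, hl]
  have hd : ∀ A B, dirDeriv Z (e s) (A - B) = dirDeriv Z (e s) A - dirDeriv Z (e s) B :=
    fun A B => by simp only [dirDeriv_eq_fderiv, map_sub]
  change dirDeriv (nabla Y Z) (e s) (X (e s)) - (e s).christoffel (nabla Y Z (e s)) (X (e s))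
    - (dirDeriv (nabla X Z) (e s) (Y (e s)) - (e s).christoffel (nabla X Z (e s)) (Y (e s)))
    - (dirDeriv Z (e s) (bracket X Y (e s)) - (e s).christoffel (Z (e s)) (bracket X Y (e s))) = _
  rw [dirDeriv_nabla hY hZ, dirDeriv_nabla hX hZ, hsymm]
  simp only [nabla, bracket, christoffel_e, curvatureId, hl, hr, hd]
  abel

theorem curvature_e (u v w : Model s) : (e s).curvature u v w = curvatureId u v w :=
  curvatureField_e contMDiff_const contMDiff_const contMDiff_const

end KS

/-! ### The Kähler structure at the identity -/

section mean

variable {r : ℝ} [hr : Fact (3 / 2 < r)]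

theorem Sob.mul_comm_fn (f g : Sob r) : f * g = g * f := Sob.ext_fn fun x => by simp [mul_comm]

theorem Sob.eq_zero_of_mean_sq_add_sq {f g : Sob r} (h : Sob.mean (f * f + g * g) = 0) :
    f = 0 ∧ g = 0 := by
  have hz : ∀ x, f.fn x = 0 ∧ g.fn x = 0 := by
    by_contra! hne
    obtain ⟨x, hx⟩ := hne
    have hp : Function.Periodic (f * f + g * g).fn 1 := Sob.fn_add_one _
    obtain ⟨y, hy, hxy⟩ := hp.exists_mem_Ico₀ one_pos x
    have hpos : 0 < (f * f + g * g).fn x := by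
      simp only [Sob.fn_add, Sob.fn_mul]
      by_cases hf : f.fn x = 0
      · have := mul_self_pos.2 (hx hf)
        nlinarith [mul_self_nonneg (f.fn x)]
      · have := mul_self_pos.2 hf
        nlinarith [mul_self_nonneg (g.fn x)]
    refine (intervalIntegral.integral_pos one_pos (Sob.continuous_fn (f * f + g * g)).continuousOn
      (fun z _ => ?_) ⟨y, ⟨hy.1, hy.2.le⟩, hxy ▸ hpos⟩).ne' h
    simp only [Sob.fn_add, Sob.fn_mul]
    nlinarith [mul_self_nonneg (f.fn z), mul_self_nonneg (g.fn z)]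
  exact ⟨Sob.ext_fn fun x => by simp [(hz x).1], Sob.ext_fn fun x => by simp [(hz x).2]⟩

/-- The algebraic identity behind the curvature formula: after contraction the terms of degree four
cancel, and only products of means of quadratic terms remain. The real numbers `κᵢ` are additive
constants, which do not contribute because `a` and `b` have zero mean. -/
theorem mean_curvature_contraction (a b c d : Sob r) (ha : Sob.mean a = 0) (hb : Sob.mean b = 0)
    (S T Q Q' l m n κ₁ κ₂ κ₃ κ₄ κ₅ κ₆ κ₇ κ₈ : ℝ) (p q p' q' : Sob r)
    (hp : p = (1 / 2 : ℝ) • (c * c + d * d - T • Sob.one r))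
    (hq : q = -(1 / 2 : ℝ) • (c * d + c * d - Q • Sob.one r))
    (hp' : p' = (1 / 2 : ℝ) • (c * a + d * b - S • Sob.one r))
    (hq' : q' = -(1 / 2 : ℝ) • (c * b + a * d - Q' • Sob.one r)) :
    Sob.mean (
      ((1 / 2 : ℝ) • ((d * b - c * a) * c - l • b - m • d - κ₁ • Sob.one r - S • c)
        - (1 / 2 : ℝ) • ((d * d - c * c) * a - n • d - n • d - κ₂ • Sob.one r - T • a)
        + (1 / 2 : ℝ) • (p * a + q * b - κ₃ • Sob.one r)
        - (1 / 2 : ℝ) • (p' * c + q' * d - κ₄ • Sob.one r)) * a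
      + ((1 / 2 : ℝ) • ((c * b + a * d) * c + m • c + l • a - κ₅ • Sob.one r)
        - (1 / 2 : ℝ) • ((c * d + c * d) * a + n • c + n • c - κ₆ • Sob.one r)
        + (-(1 / 2 : ℝ)) • (p * b + a * q - κ₇ • Sob.one r)
        - (-(1 / 2 : ℝ)) • (p' * d + c * q' - κ₈ • Sob.one r)) * b)
      = (n - m / 2 - Q' / 4) * (Sob.mean (a * d) - Sob.mean (b * c))
        - S / 4 * Sob.mean (a * c + b * d) + T / 4 * Sob.mean (a * a + b * b) := by
  have key : ∀ X : Sob r, X = (n - m / 2 - Q' / 4) • (a * d - b * c)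
      - (S / 4) • (a * c + b * d) + (T / 4) • (a * a + b * b)
      + ((κ₂ - κ₁ - κ₃ + κ₄) / 2) • a + ((κ₆ - κ₅ + κ₇ - κ₈) / 2) • b →
      Sob.mean X = (n - m / 2 - Q' / 4) * (Sob.mean (a * d) - Sob.mean (b * c))
        - S / 4 * Sob.mean (a * c + b * d) + T / 4 * Sob.mean (a * a + b * b) := by
    rintro X rfl
    simp only [map_add, map_sub, map_smul, ha, hb, smul_eq_mul]
    ring
  refine key _ (Sob.ext_fn fun x => ?_)
  subst hp hq hp' hq'
  simp only [Sob.fn_add, Sob.fn_sub, Sob.fn_mul, Sob.fn_smul, Sob.fn_one]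
  ring

end mean

namespace KS

variable {s : ℝ} [hs : Fact (5 / 2 < s)]

theorem deriv_phi_e (x : ℝ) : deriv (e s).phi x = 1 := by
  have h := ((e s).diffeo.hasDerivAt_lift x).deriv
  have hd : (e s).diffeo.disp = 0 := rfl
  rw [hd, jac_zero, Sob.fn_one] at h
  exact h

theorem proj_e (ρ : SobModConst (s - 1)) (x : ℝ) : (e s).proj ρ x = ρ.piL.fn x := by
  obtain ⟨f, hf, hfe⟩ := ρ.exists_fn_eq_rep
  have h : f.fn x = ρ.piL.fn x + Sob.mean f := by
    nth_rw 1 [hfe]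
    simp
  simp only [proj, deriv_phi_e, mul_one, ← hf, ← Sob.mean_apply, h]
  ring

theorem metric_e (U V : Model s) : (e s).metric U V
    = 1 / 4 * Sob.mean (Sob₀.derivL U.1 * Sob₀.derivL V.1 + U.2.piL * V.2.piL) := by
  rw [Sob.mean_apply]
  simp [metric, deriv_phi_e, proj_e]

theorem metric_comm (U V : Model s) : (e s).metric U V = (e s).metric V U := by
  rw [metric_e, metric_e, Sob.mul_comm_fn, Sob.mul_comm_fn U.2.piL]

theorem metric_add_left (U V W : Model s) :
    (e s).metric (U + V) W = (e s).metric U W + (e s).metric V W := by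
  have h : Sob₀.derivL (U + V).1 * Sob₀.derivL W.1 + (U + V).2.piL * W.2.piL
      = (Sob₀.derivL U.1 * Sob₀.derivL W.1 + U.2.piL * W.2.piL)
        + (Sob₀.derivL V.1 * Sob₀.derivL W.1 + V.2.piL * W.2.piL) :=
    Sob.ext_fn fun x => by simp [-Sob₀.fn_derivL]; ring
  rw [metric_e, metric_e, metric_e, h, map_add, mul_add]

theorem metric_smul_left (t : ℝ) (U W : Model s) :
    (e s).metric (t • U) W = t * (e s).metric U W := by
  have h : Sob₀.derivL (t • U).1 * Sob₀.derivL W.1 + (t • U).2.piL * W.2.piL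
      = t • (Sob₀.derivL U.1 * Sob₀.derivL W.1 + U.2.piL * W.2.piL) :=
    Sob.ext_fn fun x => by simp [-Sob₀.fn_derivL]; ring
  rw [metric_e, metric_e, h, map_smul, smul_eq_mul, mul_left_comm]

theorem metric_add_right (U V W : Model s) :
    (e s).metric W (U + V) = (e s).metric W U + (e s).metric W V := by
  simp only [metric_comm W, metric_add_left]

theorem metric_smul_right (t : ℝ) (U W : Model s) :
    (e s).metric W (t • U) = t * (e s).metric W U := by
  simp only [metric_comm W, metric_smul_left]

theorem metric_self_nonneg (U : Model s) : 0 ≤ (e s).metric U U := by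
  rw [metric_e, Sob.mean_apply]
  refine mul_nonneg (by norm_num) (intervalIntegral.integral_nonneg zero_le_one fun x _ => ?_)
  simp only [Sob.fn_add, Sob.fn_mul]
  exact add_nonneg (mul_self_nonneg _) (mul_self_nonneg _)

theorem eq_zero_of_metric_self_eq_zero {U : Model s} (h : (e s).metric U U = 0) : U = 0 := by
  rw [metric_e] at h
  obtain ⟨h1, h2⟩ := Sob.eq_zero_of_mean_sq_add_sq ((mul_eq_zero.1 h).resolve_left (by norm_num))
  exact Prod.ext (Sob₀.derivL_injective (by rw [h1]; simp))
    (SobModConst.piL_injective (by rw [h2]; simp))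

theorem metric_self_pos {U : Model s} (h : U ≠ 0) : 0 < (e s).metric U U :=
  lt_of_le_of_ne (metric_self_nonneg U) fun h0 => h (eq_zero_of_metric_self_eq_zero h0.symm)

/-- Integration by parts on the circle. -/
theorem integral_deriv_rep_mul (ρ : SobModConst (s - 1)) (f : Sob₀ s) :
    ∫ x in (0 : ℝ)..1, deriv ρ.rep x * (f : Sob s).fn x
      = -Sob.mean (ρ.piL * Sob₀.derivL f) := by
  obtain ⟨g, hg, hge⟩ := ρ.exists_fn_eq_rep
  have h1 := intervalIntegral.integral_deriv_mul_eq_sub (a := 0) (b := 1)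
    (fun x _ => g.hasDerivAt_fn x) (fun x _ => (f : Sob s).hasDerivAt_fn x)
    ((Sob.continuous_deriv Fact.out g).intervalIntegrable _ _)
    ((Sob.continuous_deriv Fact.out (f : Sob s)).intervalIntegrable _ _)
  have hf1 := (f : Sob s).fn_add_one 0
  rw [zero_add, Sob₀.fn_zero] at hf1
  rw [Sob₀.fn_zero, hf1, intervalIntegral.integral_add] at h1
  · have h2 : g * Sob₀.derivL f = ρ.piL * Sob₀.derivL f + Sob.mean g • Sob₀.derivL f := by
      nth_rw 1 [hge]
      exact Sob.ext_fn fun x => by simp; ring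
    have h3 := congrArg Sob.mean h2
    simp only [map_add, map_smul, Sob₀.mean_derivL, smul_zero, add_zero] at h3
    rw [← h3, Sob.mean_apply, ← hg]
    simp only [Sob.fn_mul, Sob₀.fn_derivL]
    linarith
  · exact ((Sob.continuous_deriv Fact.out g).mul (f : Sob s).continuous_fn).intervalIntegrable _ _
  · exact (g.continuous_fn.mul (Sob.continuous_deriv Fact.out (f : Sob s))).intervalIntegrable _ _

theorem omega_e (u v : Model s) : (e s).omega u v
    = 1 / 4 * (Sob.mean (Sob₀.derivL u.1 * v.2.piL) - Sob.mean (u.2.piL * Sob₀.derivL v.1)) := by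
  have hc : ∀ (ρ : SobModConst (s - 1)) (f : Sob₀ s), IntervalIntegrable
      (fun x => deriv ρ.rep x * (f : Sob s).fn x) volume 0 1 := fun ρ f => by
    obtain ⟨g, hg, -⟩ := ρ.exists_fn_eq_rep
    rw [← hg]
    exact ((Sob.continuous_deriv Fact.out g).mul (f : Sob s).continuous_fn).intervalIntegrable _ _
  unfold omega
  rw [intervalIntegral.integral_sub (hc _ _) (hc _ _), integral_deriv_rep_mul,
    integral_deriv_rep_mul, Sob.mul_comm_fn v.2.piL]
  ring

/-- The derivative of `(J u)₁` is `-π(u₂)`, and `u₁ₓ` represents `(J u)₂`. -/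
theorem J_e (u : Model s) : Sob₀.derivL ((e s).J u).1 = -u.2.piL ∧
    ((e s).J u).2.piL = Sob₀.derivL u.1 := by
  have h1 : ((e s).J u).1 = -Sob.primL u.2.piL := Sob₀.ofFun_eq fun x => by
    simp [deriv_phi_e, proj_e, Sob.fn_primL]
  have h2 : ((e s).J u).2 = Submodule.Quotient.mk (Sob₀.derivL u.1) :=
    congrArg Submodule.Quotient.mk (Sob.ofFun_eq fun x => by simp [deriv_phi_e])
  rw [h1, h2]
  simp

/-- The form `ω` is the Kähler form of the metric and `J`. -/
theorem metric_J_left (u v : Model s) : (e s).metric ((e s).J u) v = (e s).omega u v := by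
  rw [metric_e, omega_e, (J_e u).1, (J_e u).2, ← map_sub]
  refine congrArg (fun f : Sob (s - 1) => 1 / 4 * Sob.mean f) (Sob.ext_fn fun x => ?_)
  simp [-Sob₀.fn_derivL]
  ring

theorem metric_J_self (u : Model s) : (e s).metric ((e s).J u) u = 0 := by
  rw [metric_J_left, omega_e, Sob.mul_comm_fn]
  ring

theorem metric_J_J (u : Model s) : (e s).metric ((e s).J u) ((e s).J u) = (e s).metric u u := by
  rw [metric_e, metric_e, (J_e u).1, (J_e u).2]
  refine congrArg (fun f : Sob (s - 1) => 1 / 4 * Sob.mean f) (Sob.ext_fn fun x => ?_)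
  simp [-Sob₀.fn_derivL]
  ring

theorem derivL_christoffelId (U V : Model s) : Sob₀.derivL (christoffelId U V).1
    = (1 / 2 : ℝ) • (Sob₀.derivL U.1 * Sob₀.derivL V.1 + U.2.piL * V.2.piL
      - Sob.mean (Sob₀.derivL U.1 * Sob₀.derivL V.1 + U.2.piL * V.2.piL) • Sob.one (s - 1)) := by
  simp only [christoffelId, map_smul, Sob.derivL_primL]

theorem piL_christoffelId (U V : Model s) : (christoffelId U V).2.piL
    = -(1 / 2 : ℝ) • (Sob₀.derivL U.1 * V.2.piL + Sob₀.derivL V.1 * U.2.piL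
      - Sob.mean (Sob₀.derivL U.1 * V.2.piL + Sob₀.derivL V.1 * U.2.piL) • Sob.one (s - 1)) := by
  simp only [christoffelId, map_smul, SobModConst.piL_mkQL]

/-- The constant `κ` is a mean value; it is irrelevant because it is paired with functions of zero
mean. -/
theorem derivL_christoffelDeriv (k : Sob₀ s) (U V : Model s) :
    ∃ κ : ℝ, Sob₀.derivL (christoffelDeriv k U V).1 = (1 / 2 : ℝ) •
      ((U.2.piL * V.2.piL - Sob₀.derivL U.1 * Sob₀.derivL V.1) * Sob₀.derivL k
        - Sob.mean (U.2.piL * Sob₀.derivL k) • V.2.piL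
        - Sob.mean (V.2.piL * Sob₀.derivL k) • U.2.piL - κ • Sob.one (s - 1)
        - Sob.mean (Sob₀.derivL U.1 * Sob₀.derivL V.1 + U.2.piL * V.2.piL) • Sob₀.derivL k) := by
  simp only [christoffelDeriv, map_smul, map_sub Sob₀.derivL, Sob.derivL_primL]
  exact ⟨_, rfl⟩

theorem piL_christoffelDeriv (k : Sob₀ s) (U V : Model s) :
    ∃ κ : ℝ, (christoffelDeriv k U V).2.piL = (1 / 2 : ℝ) •
      ((Sob₀.derivL U.1 * V.2.piL + Sob₀.derivL V.1 * U.2.piL) * Sob₀.derivL k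
        + Sob.mean (V.2.piL * Sob₀.derivL k) • Sob₀.derivL U.1
        + Sob.mean (U.2.piL * Sob₀.derivL k) • Sob₀.derivL V.1 - κ • Sob.one (s - 1)) := by
  simp only [christoffelDeriv, map_smul, SobModConst.piL_mkQL]
  exact ⟨_, rfl⟩

/-- The curvature formula; only `mean_curvature_contraction` and commutativity are used. -/
theorem metric_curvature (u v : Model s) :
    (e s).metric ((e s).curvature u v v) u
      = (e s).metric u u * (e s).metric v v - (e s).metric u v ^ 2 + 3 * (e s).omega u v ^ 2 := by
  obtain ⟨κ₁, h₁⟩ := derivL_christoffelDeriv v.1 v u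
  obtain ⟨κ₂, h₂⟩ := derivL_christoffelDeriv u.1 v v
  obtain ⟨κ₅, h₅⟩ := piL_christoffelDeriv v.1 v u
  obtain ⟨κ₆, h₆⟩ := piL_christoffelDeriv u.1 v v
  rw [curvature_e, metric_e, curvatureId]
  simp only [Prod.fst_add, Prod.fst_sub, Prod.snd_add, Prod.snd_sub, map_add Sob₀.derivL,
    map_sub Sob₀.derivL, map_add SobModConst.piL, map_sub SobModConst.piL, h₁, h₂, h₅, h₆,
    derivL_christoffelId (christoffelId v v) u, derivL_christoffelId (christoffelId v u) v,
    piL_christoffelId (christoffelId v v) u, piL_christoffelId (christoffelId v u) v]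
  rw [mean_curvature_contraction _ _ _ _ (Sob₀.mean_derivL _) (SobModConst.mean_piL _)
    _ _ _ _ _ _ _ _ _ _ _ _ _ _ _ _ _ _ _ (derivL_christoffelId v v) (piL_christoffelId v v)
    (derivL_christoffelId v u) (piL_christoffelId v u)]
  rw [metric_e, metric_e, metric_e, omega_e, Sob.mul_comm_fn v.2.piL (Sob₀.derivL u.1),
    Sob.mul_comm_fn (Sob₀.derivL v.1) u.2.piL, Sob.mul_comm_fn (Sob₀.derivL v.1) (Sob₀.derivL u.1),
    Sob.mul_comm_fn v.2.piL u.2.piL]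
  simp only [map_add]
  ring

/-- The squared area of the parallelogram spanned by linearly independent vectors is positive. -/
theorem gram_pos {u v : Model s} (h : LinearIndependent ℝ ![u, v]) :
    0 < (e s).metric u u * (e s).metric v v - (e s).metric u v ^ 2 := by
  have hu : u ≠ 0 := h.ne_zero 0
  have hN := metric_self_pos hu
  have hz : (e s).metric u u • v + (-(e s).metric u v) • u ≠ 0 := fun h0 => by
    rw [LinearIndependent.pair_iff] at h
    rw [add_comm] at h0
    exact hN.ne' (h _ _ h0).2
  have hp := metric_self_pos hz
  simp only [metric_add_left, metric_add_right, metric_smul_left, metric_smul_right,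
    metric_comm v u] at hp
  refine pos_of_mul_pos_right (a := (e s).metric u u) ?_ hN.le
  linarith

/-- The component of `‖u‖² v` orthogonal to `u` and `J u`. -/
def remainder (u v : Model s) : Model s :=
  (e s).metric u u • v + (-(e s).metric u v) • u + (-(e s).omega u v) • (e s).J u

theorem metric_remainder (u v : Model s) : (e s).metric (remainder u v) (remainder u v)
    = (e s).metric u u *
      ((e s).metric u u * (e s).metric v v - (e s).metric u v ^ 2 - (e s).omega u v ^ 2) := by
  have h1 := metric_J_J u
  have h2 := metric_J_self u
  have h3 := metric_J_left u v
  have h4 := (metric_comm u ((e s).J u)).trans h2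
  have h5 := (metric_comm v ((e s).J u)).trans h3
  simp only [remainder, metric_add_left, metric_add_right, metric_smul_left, metric_smul_right,
    metric_comm v u, h1, h2, h3, h4, h5]
  ring

/-- Cauchy-Schwarz for `Ju` and the part of `v` orthogonal to `u`. -/
theorem omega_sq_le {u : Model s} (hu : u ≠ 0) (v : Model s) : (e s).omega u v ^ 2
    ≤ (e s).metric u u * (e s).metric v v - (e s).metric u v ^ 2 := by
  have h := metric_self_nonneg (remainder u v)
  rw [metric_remainder] at h
  have := nonneg_of_mul_nonneg_right h (metric_self_pos hu)
  linarith

/-- Equality in `omega_sq_le` means that `J u` is a combination of `u` and `v`. -/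
theorem omega_sq_eq_iff {u v : Model s} (h : LinearIndependent ℝ ![u, v]) :
    (e s).omega u v ^ 2 = (e s).metric u u * (e s).metric v v - (e s).metric u v ^ 2 ↔
      ∃ x y : ℝ, x • u + y • v = (e s).J u := by
  have hN : 0 < (e s).metric u u := metric_self_pos (h.ne_zero 0)
  have hg := gram_pos h
  constructor
  · intro heq
    have hr : remainder u v = 0 := eq_zero_of_metric_self_eq_zero (by
      rw [metric_remainder, heq]; ring)
    have hω : (e s).omega u v ≠ 0 := fun h0 => by
      rw [h0] at heq
      simp only [ne_eq, OfNat.ofNat_ne_zero, not_false_eq_true, zero_pow] at heq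
      exact hg.ne heq
    refine ⟨-(e s).metric u v / (e s).omega u v, (e s).metric u u / (e s).omega u v, ?_⟩
    have h1 : (e s).metric u u • v + (-(e s).metric u v) • u = (e s).omega u v • (e s).J u := by
      unfold remainder at hr
      rw [neg_smul ((e s).omega u v), ← sub_eq_add_neg, sub_eq_zero] at hr
      exact hr
    rw [← inv_smul_smul₀ hω ((e s).J u), ← h1, smul_add, smul_smul, smul_smul, add_comm]
    congr 2 <;> ring
  · rintro ⟨x, y, hxy⟩
    -- pair `J u = x u + y v` with `u`, with `v` and with itself
    have h1 := metric_J_self u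
    have h2 := metric_J_left u v
    have h3 : (e s).metric ((e s).J u) (x • u + y • v) = (e s).metric u u := by
      rw [hxy, metric_J_J]
    rw [metric_add_right, metric_smul_right, metric_smul_right, h1, h2] at h3
    rw [← hxy, metric_add_left, metric_smul_left, metric_smul_left, metric_comm v u] at h1
    rw [← hxy, metric_add_left, metric_smul_left, metric_smul_left] at h2
    refine mul_left_cancel₀ hN.ne' ?_
    set N := (e s).metric u u
    set M := (e s).metric v v
    set l := (e s).metric u v
    set w := (e s).omega u v
    -- `N w = y (N M - l²)` and `N = y w`
    have h4 : N * w = y * (N * M - l ^ 2) := by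
      rw [← h2]; linear_combination l * h1
    linear_combination w * h4 + (N * M - l ^ 2) * h3

theorem sec_e {u v : Model s} (h : LinearIndependent ℝ ![u, v]) : (e s).sec u v
    = 1 + 3 * ((e s).omega u v ^ 2
      / ((e s).metric u u * (e s).metric v v - (e s).metric u v ^ 2)) := by
  have hg := (gram_pos h).ne'
  rw [sec, metric_curvature]
  field_simp

theorem sec_eq_four_iff {u v : Model s} (h : LinearIndependent ℝ ![u, v]) : (e s).sec u v = 4 ↔
    ∃ x y : ℝ, x • u + y • v = (e s).J u := by
  have hg := (gram_pos h).ne'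
  rw [sec_e h, ← omega_sq_eq_iff h, ← div_eq_one_iff_eq hg]
  constructor <;> intro h <;> linarith

end KS

end HunterSaxton

end

open HunterSaxton in
theorem corollary6p2 (s : ℝ) [Fact (5 / 2 < s)] :
    (∀ X Y Z : KS s → Model s,
      ContMDiff 𝓘(ℝ, Model s) 𝓘(ℝ, Model s) ∞ X →
      ContMDiff 𝓘(ℝ, Model s) 𝓘(ℝ, Model s) ∞ Y →
      ContMDiff 𝓘(ℝ, Model s) 𝓘(ℝ, Model s) ∞ Z →
      KS.curvatureField X Y Z (KS.e s)
        = (KS.e s).curvature (X (KS.e s)) (Y (KS.e s)) (Z (KS.e s))) ∧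
    (∀ u v : Model s,
      (KS.e s).metric ((KS.e s).curvature u v v) u
        = (KS.e s).metric u u * (KS.e s).metric v v - (KS.e s).metric u v ^ 2
          + 3 * (KS.e s).omega u v ^ 2) ∧
    (∀ u v : Model s, LinearIndependent ℝ ![u, v] →
      1 ≤ (KS.e s).sec u v ∧ (KS.e s).sec u v ≤ 4 ∧
      ((KS.e s).metric u v = 0 →
        ((KS.e s).sec u v = 4 ↔ ∃ c : ℝ, (KS.e s).J u = c • v)) ∧
      ((KS.e s).sec u v = 4 ↔ (KS.e s).J u ∈ Submodule.span ℝ {u, v})) := by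
  refine ⟨fun X Y Z hX hY hZ => ?_, KS.metric_curvature, fun u v h => ?_⟩
  · rw [KS.curvatureField_e hX hY hZ, KS.curvature_e]
  have hg := KS.gram_pos h
  have hu : u ≠ 0 := h.ne_zero 0
  refine ⟨?_, ?_, fun huv => ?_, ?_⟩
  · rw [KS.sec_e h]
    have := div_nonneg (sq_nonneg ((KS.e s).omega u v)) hg.le
    linarith
  · rw [KS.sec_e h]
    have := (div_le_one hg).2 (KS.omega_sq_le hu v)
    linarith
  · rw [KS.sec_eq_four_iff h]
    constructor
    · rintro ⟨x, y, hxy⟩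
      -- pairing with `u` shows that the coefficient of `u` vanishes
      have h1 := KS.metric_J_self u
      rw [← hxy, KS.metric_add_left, KS.metric_smul_left, KS.metric_smul_left, KS.metric_comm v u,
        huv, mul_zero, add_zero] at h1
      have hx : x = 0 := (mul_eq_zero.1 h1).resolve_right (KS.metric_self_pos hu).ne'
      exact ⟨y, by rw [← hxy, hx, zero_smul, zero_add]⟩
    · rintro ⟨c, hc⟩
      exact ⟨0, c, by rw [hc, zero_smul, zero_add]⟩
  · rw [KS.sec_eq_four_iff h, Submodule.mem_span_pair]
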